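/- **Conventions.** Algorithms are partial recursive functions; they must terminate with a correct output on all admissible inputs. A *data structure* for a category $\mathcal A$ consists of two decidable sets of finite data (codes of objects, codes of morphisms), an object of $\mathcal A$ for every code of an object, and, for all codes $a,b$ of objects, a partial map from the codes of morphisms to $\mathrm{Hom}_{\mathcal A}(a,b)$. An Abelian category $\mathcal A$ with a data structure is *constructively Abelian* if every object is isomorphic to one that has a code, every morphism between coded objects has a code, and there are algorithms, on codes, that: produce identity morphisms; compose morphisms; decide whether a given datum is the code of a morphism from $a$ to $b$; decide whether two morphisms from $a$ to $b$ are equal; add and subtract parallel morphisms; produce zero morphisms and a zero object; produce the product of two objects with its projections, and the unique pairing of two morphisms; produce the kernel of a morphism and unique lifts along it; produce the cokernel of a morphism and unique colifts along it; produce the unique lift along a mono $\kappa$ of a morphism whose composition with the cokernel of $\kappa$ vanishes; produce the unique colift along an epi $\epsilon$ of a morphism whose composition with the kernel of $\epsilon$ vanishes. Let $\mathcal A$ be an Abelian category and $\mathcal C\subseteq\mathcal A$ a thick subcategory (non-empty, full, closed under subobjects, factor objects and extensions). Let $\mathscr Q:\mathcal A\to\mathcal A/\mathcal C$ be the Serre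 quotient, i.e. the localization of $\mathcal A$ at the morphisms whose kernel and cokernel lie in $\mathcal C$. A *Gabriel morphism* from $M$ to $N$ is a triple $(\imath,\varphi,\jmath)$, $M\xleftarrow{\imath}M'\xrightarrow{\varphi}N'\xleftarrow{\jmath}N$, with $\imath$ a mono, $\jmath$ an epi, $\operatorname{coker}\imath\in\mathcal C$ and $\ker\jmath\in\mathcal C$, up to isomorphisms of $M'$ and $N'$ compatible with the three maps. It represents the morphism $\mathscr Q(\imath)^{-1}\mathscr Q(\varphi)\mathscr Q(\jmath)^{-1}$ of $\mathcal A/\mathcal C$ (composition written from left to right). The sum and the difference of two parallel Gabriel morphisms are formed after restricting both to the pullback of the two monos and extending both to the pushout of the two epis, and $-[\imath,\varphi,\jmath]=[\imath,-\varphi,\jmath]$. The *zeroid* of this commutative inverse monoid $G(M,N)$ is the class of its idempotents under the smallest group congruence: $\phi\sim\psi$ iff there is a $\chi$ with $\chi\le\phi$ and $\chi\le\psi$, where $\chi\le\phi$ means $\chi=\phi-\chi+\chi$. **Theorem.** Let $\mathcal A$, with a given data structure, be constructively Abelian, and let $\mathcal C$ be a thick subcategory of $\mathcal A$ such that it is decidable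 whether a coded object of $\mathcal A$ lies in $\mathcal C$. Then $\mathcal A/\mathcal C$ is Abelian, $\mathscr Q$ is additive, and: 1. $\mathcal A/\mathcal C$ is constructively Abelian for the data structure in which a code of an object $M$ of $\mathcal A$ is a code of $\mathscr Q(M)$, and a code of a morphism is a tuple of codes for $M',N',\imath,\varphi,\jmath$, where $(\imath,\varphi,\jmath)$ represents a Gabriel morphism. 2. For all $M,N$ in $\mathcal A$, the map $G(M,N)\to\mathrm{Hom}_{\mathcal A/\mathcal C}(\mathscr Q M,\mathscr Q N)$ is surjective and additive, and $\phi,\psi\in G(M,N)$ have the same image iff there is a $\chi\in G(M,N)$ with $\chi\le\phi$ and $\chi\le\psi$. 3. $\phi,\psi\in G(M,N)$ represent the same morphism of $\mathcal A/\mathcal C$ iff $\phi-\psi$ lies in the zeroid of $G(M,N)$. There are algorithms that compute, on codes, the difference of two parallel Gabriel morphisms, and that decide whether a Gabriel morphism lies in the zeroid. -/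

import Mathlib

open CategoryTheory CategoryTheory.Limits

/-! ### Categories presented by codes, and their algorithms

Algorithms are partial recursive functions (`Partrec`) on `Primcodable` types of codes.  An algorithm
has to terminate with a correct output on every admissible input; nothing is required of it
elsewhere. -/

/-- A data structure for a category `A`: a type of codes of objects, a type of codes of morphisms,
and their interpretation in `A`.  For codes `a`, `b` of objects, `hom a b c` is the morphism from
`obj a` to `obj b` with code `c`, and is undefined if `c` is not the code of such a morphism.  An
object or a morphism may have several codes. -/
structure Coding (A : Type*) [Category* A] where
  Obj : Type
  Mor : Type
  [primcodableObj : Primcodable Obj]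
  [primcodableMor : Primcodable Mor]
  obj : Obj → A
  hom : ∀ a b : Obj, Mor →. (obj a ⟶ obj b)

namespace Coding

attribute [instance] Coding.primcodableObj Coding.primcodableMor

section

variable {A : Type*} [Category* A] (κ : Coding A)

/-- The output `x` of an algorithm is the code of a morphism from `obj a` to `obj b` with the
property `p`. -/
def Outputs (x : Part κ.Mor) (a b : κ.Obj) (p : (κ.obj a ⟶ κ.obj b) → Prop) : Prop :=
  ∃ c ∈ x, ∃ f ∈ κ.hom a b c, p f

/-- The output `x` of an algorithm is the code of the only morphism from `obj a` to `obj b` with the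
property `p`. -/
def OutputsUnique (x : Part κ.Mor) (a b : κ.Obj) (p : (κ.obj a ⟶ κ.obj b) → Prop) : Prop :=
  κ.Outputs x a b fun f => p f ∧ ∀ f', p f' → f' = f

/-- The category `A`, with the data structure `κ`, is constructively Abelian: it is Abelian, its
objects (up to isomorphism) and its morphisms are the ones that have codes, and every existential
quantifier and every disjunction in the axioms of an Abelian category is realised by an
algorithm. -/
structure IsConstructivelyAbelian [Abelian A] : Prop where
  obj_complete : ∀ X : A, ∃ a, Nonempty (κ.obj a ≅ X)
  hom_complete : ∀ (a b) (f : κ.obj a ⟶ κ.obj b), ∃ c, f ∈ κ.hom a b c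
  /-- identity morphisms -/
  identity : ∃ F : κ.Obj →. κ.Mor, Partrec F ∧
    ∀ a, κ.Outputs (F a) a a fun h => h = 𝟙 (κ.obj a)
  /-- composition -/
  composition : ∃ F : κ.Obj × κ.Obj × κ.Obj × κ.Mor × κ.Mor →. κ.Mor, Partrec F ∧
    ∀ a b c m n, ∀ f ∈ κ.hom a b m, ∀ g ∈ κ.hom b c n,
      κ.Outputs (F (a, b, c, m, n)) a c fun h => h = f ≫ g
  /-- membership in the sets of morphisms is decidable -/
  membership : ComputablePred fun x : κ.Obj × κ.Obj × κ.Mor => (κ.hom x.1 x.2.1 x.2.2).Dom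
  /-- equality of two morphisms is decidable -/
  equality : ∃ F : κ.Obj × κ.Obj × κ.Mor × κ.Mor →. Bool, Partrec F ∧
    ∀ a b m n, ∀ f ∈ κ.hom a b m, ∀ g ∈ κ.hom a b n,
      ∃ r ∈ F (a, b, m, n), r = true ↔ f = g
  /-- addition -/
  addition : ∃ F : κ.Obj × κ.Obj × κ.Mor × κ.Mor →. κ.Mor, Partrec F ∧
    ∀ a b m n, ∀ f ∈ κ.hom a b m, ∀ g ∈ κ.hom a b n,
      κ.Outputs (F (a, b, m, n)) a b fun h => h = f + g
  /-- subtraction -/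
  subtraction : ∃ F : κ.Obj × κ.Obj × κ.Mor × κ.Mor →. κ.Mor, Partrec F ∧
    ∀ a b m n, ∀ f ∈ κ.hom a b m, ∀ g ∈ κ.hom a b n,
      κ.Outputs (F (a, b, m, n)) a b fun h => h = f - g
  /-- zero morphisms -/
  zeroMorphism : ∃ F : κ.Obj × κ.Obj →. κ.Mor, Partrec F ∧
    ∀ a b, κ.Outputs (F (a, b)) a b fun h => h = 0
  /-- a zero object -/
  zeroObject : ∃ z, IsZero (κ.obj z)
  /-- binary products with their projections, and pairings -/
  product : ∃ (P : κ.Obj × κ.Obj →. κ.Obj × κ.Mor × κ.Mor)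
      (F : κ.Obj × κ.Obj × κ.Obj × κ.Mor × κ.Mor →. κ.Mor), Partrec P ∧ Partrec F ∧
    ∀ a₁ a₂, ∃ p m₁ m₂, (p, m₁, m₂) ∈ P (a₁, a₂) ∧
      ∃ π₁ ∈ κ.hom p a₁ m₁, ∃ π₂ ∈ κ.hom p a₂ m₂,
        ∀ l n₁ n₂, ∀ f₁ ∈ κ.hom l a₁ n₁, ∀ f₂ ∈ κ.hom l a₂ n₂,
          κ.OutputsUnique (F (a₁, a₂, l, n₁, n₂)) l p fun u => u ≫ π₁ = f₁ ∧ u ≫ π₂ = f₂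
  /-- kernels, and lifts along them -/
  kernels : ∃ (K : κ.Obj × κ.Obj × κ.Mor →. κ.Obj × κ.Mor)
      (F : κ.Obj × κ.Obj × κ.Mor × κ.Obj × κ.Mor →. κ.Mor), Partrec K ∧ Partrec F ∧
    ∀ a b m, ∀ f ∈ κ.hom a b m, ∃ k n, (k, n) ∈ K (a, b, m) ∧
      ∃ i ∈ κ.hom k a n, i ≫ f = 0 ∧
        ∀ l q, ∀ t ∈ κ.hom l a q, t ≫ f = 0 →
          κ.OutputsUnique (F (a, b, m, l, q)) l k fun u => u ≫ i = t
  /-- cokernels, and colifts along them -/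
  cokernels : ∃ (K : κ.Obj × κ.Obj × κ.Mor →. κ.Obj × κ.Mor)
      (F : κ.Obj × κ.Obj × κ.Mor × κ.Obj × κ.Mor →. κ.Mor), Partrec K ∧ Partrec F ∧
    ∀ a b m, ∀ f ∈ κ.hom a b m, ∃ k n, (k, n) ∈ K (a, b, m) ∧
      ∃ e ∈ κ.hom b k n, f ≫ e = 0 ∧
        ∀ l q, ∀ t ∈ κ.hom b l q, f ≫ t = 0 →
          κ.OutputsUnique (F (a, b, m, l, q)) k l fun u => e ≫ u = t
  /-- lifts along monos: every mono is the kernel of its cokernel -/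
  monoLift : ∃ F : κ.Obj × κ.Obj × κ.Mor × κ.Obj × κ.Mor →. κ.Mor, Partrec F ∧
    ∀ k a m, ∀ i ∈ κ.hom k a m, Mono i →
      ∀ l q, ∀ t ∈ κ.hom l a q, t ≫ cokernel.π i = 0 →
        κ.OutputsUnique (F (k, a, m, l, q)) l k fun u => u ≫ i = t
  /-- colifts along epis: every epi is the cokernel of its kernel -/
  epiColift : ∃ F : κ.Obj × κ.Obj × κ.Mor × κ.Obj × κ.Mor →. κ.Mor, Partrec F ∧
    ∀ b k m, ∀ e ∈ κ.hom b k m, Epi e →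
      ∀ l q, ∀ t ∈ κ.hom b l q, kernel.ι e ≫ t = 0 →
        κ.OutputsUnique (F (b, k, m, l, q)) k l fun u => e ≫ u = t

end

end Coding

/-! ### The zeroid of a commutative inverse semigroup -/

/-- The natural partial order of a commutative inverse semigroup. -/
def naturalLE {H : Type*} [Add H] [Neg H] (x h : H) : Prop := x = h + -x + x

/-- The zeroid of a commutative inverse semigroup: the class of the idempotents under the smallest
group congruence, for which `z` and `e` are congruent if they have a common lower bound in the
natural partial order. -/
def zeroid (H : Type*) [Add H] [Neg H] : Set H :=
  {z | ∃ e : H, e + e = e ∧ ∃ x : H, naturalLE x z ∧ naturalLE x e}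

/-! ### Generalized morphisms and Gabriel morphisms -/

section

universe v u

variable {A : Type u} [Category.{v} A]

/-- A triple `M ↩ dom ⟶ cod ↞ N`; it represents a generalized morphism from `M` to `N`. -/
structure GenTriple (M N : A) where
  dom : A
  cod : A
  ι : dom ⟶ M
  mid : dom ⟶ cod
  j : N ⟶ cod
  [mono_ι : Mono ι]
  [epi_j : Epi j]

namespace GenTriple

attribute [instance] GenTriple.mono_ι GenTriple.epi_j

variable {M N : A}

/-- Two triples are equivalent if they differ by isomorphisms of the two middle objects. -/
def Equivalent (s t : GenTriple M N) : Prop :=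
  ∃ (μ : s.dom ≅ t.dom) (ν : s.cod ≅ t.cod),
    μ.hom ≫ t.ι = s.ι ∧ s.j ≫ ν.hom = t.j ∧ μ.hom ≫ t.mid = s.mid ≫ ν.hom

theorem equivalent_equivalence : Equivalence (Equivalent (M := M) (N := N)) where
  refl s := ⟨Iso.refl _, Iso.refl _, by simp, by simp, by simp⟩
  symm := by
    rintro s t ⟨μ, ν, h₁, h₂, h₃⟩
    refine ⟨μ.symm, ν.symm, by simp [← h₁], by simp [← h₂], ?_⟩
    rw [Iso.symm_hom, Iso.symm_hom, Iso.inv_comp_eq, ← Category.assoc, h₃, Category.assoc,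
      Iso.hom_inv_id, Category.comp_id]
  trans := by
    rintro r s t ⟨μ, ν, h₁, h₂, h₃⟩ ⟨μ', ν', h₁', h₂', h₃'⟩
    refine ⟨μ ≪≫ μ', ν ≪≫ ν', by simp [h₁', h₁], by simp [reassoc_of% h₂, h₂'], ?_⟩
    simp [h₃', reassoc_of% h₃]

variable [Abelian A]

/-- The operation on the common adaptations of `s` and `t`, for `op` addition or subtraction. -/
noncomputable def adapt (op : ∀ {X Y : A}, (X ⟶ Y) → (X ⟶ Y) → (X ⟶ Y)) (s t : GenTriple M N) :
    GenTriple M N where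
  dom := pullback s.ι t.ι
  cod := pushout s.j t.j
  ι := pullback.fst s.ι t.ι ≫ s.ι
  mid := op (pullback.fst s.ι t.ι ≫ s.mid ≫ pushout.inl s.j t.j)
    (pullback.snd s.ι t.ι ≫ t.mid ≫ pushout.inr s.j t.j)
  j := s.j ≫ pushout.inl s.j t.j

noncomputable def add (s t : GenTriple M N) : GenTriple M N := adapt (fun f g => f + g) s t

noncomputable def sub (s t : GenTriple M N) : GenTriple M N := adapt (fun f g => f - g) s t

def neg (s : GenTriple M N) : GenTriple M N where
  dom := s.dom
  cod := s.cod
  ι := s.ι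
  mid := -s.mid
  j := s.j

theorem adapt_equivalent (op : ∀ {X Y : A}, (X ⟶ Y) → (X ⟶ Y) → (X ⟶ Y))
    (hl : ∀ {X Y Z : A} (f : X ⟶ Y) (g g' : Y ⟶ Z), f ≫ op g g' = op (f ≫ g) (f ≫ g'))
    (hr : ∀ {X Y Z : A} (f f' : X ⟶ Y) (g : Y ⟶ Z), op f f' ≫ g = op (f ≫ g) (f' ≫ g))
    {s s' t t' : GenTriple M N} (h : s.Equivalent s') (k : t.Equivalent t') :
    (adapt op s t).Equivalent (adapt op s' t') := by
  obtain ⟨μ, ν, h₁, h₂, h₃⟩ := h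
  obtain ⟨μ', ν', k₁, k₂, k₃⟩ := k
  have e₁ : s.ι ≫ 𝟙 M = μ.hom ≫ s'.ι := by simp [h₁]
  have e₂ : t.ι ≫ 𝟙 M = μ'.hom ≫ t'.ι := by simp [k₁]
  have e₃ : s.j ≫ ν.hom = 𝟙 N ≫ s'.j := by simp [h₂]
  have e₄ : t.j ≫ ν'.hom = 𝟙 N ≫ t'.j := by simp [k₂]
  let m : pullback s.ι t.ι ≅ pullback s'.ι t'.ι := asIso (pullback.map _ _ _ _ _ _ _ e₁ e₂)
  let n : pushout s.j t.j ≅ pushout s'.j t'.j := asIso (pushout.map _ _ _ _ _ _ _ e₃ e₄)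
  have m₁ : m.hom ≫ pullback.fst s'.ι t'.ι = pullback.fst s.ι t.ι ≫ μ.hom := pullback.lift_fst _ _ _
  have m₂ : m.hom ≫ pullback.snd s'.ι t'.ι = pullback.snd s.ι t.ι ≫ μ'.hom :=
    pullback.lift_snd _ _ _
  have n₁ : pushout.inl s.j t.j ≫ n.hom = ν.hom ≫ pushout.inl s'.j t'.j := pushout.inl_desc _ _ _
  have n₂ : pushout.inr s.j t.j ≫ n.hom = ν'.hom ≫ pushout.inr s'.j t'.j := pushout.inr_desc _ _ _
  refine ⟨m, n, ?_, ?_, ?_⟩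
  · simp [adapt, reassoc_of% m₁, h₁]
  · simp [adapt, n₁, ← h₂]
  · simp only [adapt, hl, hr, Category.assoc, reassoc_of% m₁, reassoc_of% m₂, n₁, n₂,
      reassoc_of% h₃, reassoc_of% k₃]

theorem neg_equivalent {s t : GenTriple M N} (h : s.Equivalent t) :
    s.neg.Equivalent t.neg := by
  obtain ⟨μ, ν, h₁, h₂, h₃⟩ := h
  exact ⟨μ, ν, h₁, h₂, by simp [neg, h₃]⟩

variable (C : ObjectProperty A)

/-- The triple represents a Gabriel morphism with respect to `C`. -/
def IsGabriel (t : GenTriple M N) : Prop := C (cokernel t.ι) ∧ C (kernel t.j)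

variable {C} [C.IsSerreClass]

theorem IsGabriel.adapt (op : ∀ {X Y : A}, (X ⟶ Y) → (X ⟶ Y) → (X ⟶ Y)) {s t : GenTriple M N}
    (hs : s.IsGabriel C) (ht : t.IsGabriel C) : (GenTriple.adapt op s t).IsGabriel C :=
  ⟨C.epiModSerre.comp_mem _ _ (MorphismProperty.pullback_fst _ _ ht.1) hs.1,
    C.monoModSerre.comp_mem _ _ hs.2 (MorphismProperty.pushout_inl _ _ ht.2)⟩

theorem IsGabriel.isoModSerre_ι {t : GenTriple M N} (h : t.IsGabriel C) : C.isoModSerre t.ι :=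
  C.isoModSerre_of_mono _ h.1

theorem IsGabriel.isoModSerre_j {t : GenTriple M N} (h : t.IsGabriel C) : C.isoModSerre t.j :=
  C.isoModSerre_of_epi _ h.2

/-- The morphism `Q(ι)⁻¹ Q(mid) Q(j)⁻¹` that the triple represents in the Serre quotient. -/
noncomputable def toQuotient {D : Type*} [Category* D] (Q : A ⥤ D)
    [Q.IsLocalization C.isoModSerre] (t : GenTriple M N) (h : t.IsGabriel C) :
    Q.obj M ⟶ Q.obj N :=
  (Localization.isoOfHom Q C.isoModSerre t.ι h.isoModSerre_ι).inv ≫ Q.map t.mid ≫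
    (Localization.isoOfHom Q C.isoModSerre t.j h.isoModSerre_j).inv

theorem toQuotient_eq {D : Type*} [Category* D] (Q : A ⥤ D)
    [Q.IsLocalization C.isoModSerre] {s t : GenTriple M N} (hs : s.IsGabriel C)
    (ht : t.IsGabriel C) (h : s.Equivalent t) : s.toQuotient Q hs = t.toQuotient Q ht := by
  obtain ⟨μ, ν, h₁, h₂, h₃⟩ := h
  rw [toQuotient, Iso.inv_comp_eq, Iso.comp_inv_eq, Localization.isoOfHom_hom,
    Localization.isoOfHom_hom, ← h₁, Q.map_comp, toQuotient]
  have e : (Localization.isoOfHom Q C.isoModSerre t.ι ht.isoModSerre_ι).hom = Q.map t.ι := rfl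
  have e' : Q.map s.j = (Localization.isoOfHom Q C.isoModSerre t.j ht.isoModSerre_j).hom ≫
      Q.map ν.inv := by
    rw [Localization.isoOfHom_hom, ← Q.map_comp, ← h₂]; simp
  rw [e', ← e]
  simp only [Category.assoc, Iso.hom_inv_id_assoc, Iso.inv_hom_id_assoc]
  rw [← Q.map_comp, ← Q.map_comp, reassoc_of% h₃, Iso.hom_inv_id, Category.comp_id]

end GenTriple

variable [Abelian A]

/-- The equivalence of triples, on the triples that represent Gabriel morphisms. -/
def gabrielSetoid (C : ObjectProperty A) (M N : A) : Setoid {t : GenTriple M N // t.IsGabriel C} :=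
  Setoid.comap Subtype.val ⟨GenTriple.Equivalent, GenTriple.equivalent_equivalence⟩

/-- The Gabriel morphisms from `M` to `N` with respect to `C`. -/
def GabrielHom (C : ObjectProperty A) (M N : A) : Type (max u v) := Quotient (gabrielSetoid C M N)

namespace GabrielHom

variable {C : ObjectProperty A} {M N : A}

/-- The Gabriel morphism that a triple represents. -/
def mk (t : GenTriple M N) (h : t.IsGabriel C) : GabrielHom C M N :=
  Quotient.mk (gabrielSetoid C M N) ⟨t, h⟩

instance : Neg (GabrielHom C M N) where
  neg := Quotient.map (fun s => ⟨s.1.neg, s.2⟩) fun _ _ h => GenTriple.neg_equivalent h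

variable [C.IsSerreClass]

noncomputable instance : Add (GabrielHom C M N) where
  add := Quotient.map₂ (fun s t => ⟨s.1.add t.1, s.2.adapt _ t.2⟩) fun _ _ h _ _ k =>
    GenTriple.adapt_equivalent _ (by simp) (by simp) h k

noncomputable instance : Sub (GabrielHom C M N) where
  sub := Quotient.map₂ (fun s t => ⟨s.1.sub t.1, s.2.adapt _ t.2⟩) fun _ _ h _ _ k =>
    GenTriple.adapt_equivalent _ (by simp) (by simp) h k

/-- The canonical map to the morphisms of the Serre quotient. -/
noncomputable def toQuotient {D : Type*} [Category* D] (Q : A ⥤ D)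
    [Q.IsLocalization C.isoModSerre] : GabrielHom C M N → (Q.obj M ⟶ Q.obj N) :=
  Quotient.lift (fun t => t.1.toQuotient Q t.2) fun s t h =>
    GenTriple.toQuotient_eq Q s.2 t.2 h

end GabrielHom

namespace Coding

variable (κ : Coding A)

/-- Codes of triples: the codes of the two middle objects and of the three morphisms. -/
abbrev TripleCode : Type := κ.Obj × κ.Obj × κ.Mor × κ.Mor × κ.Mor

variable (C : ObjectProperty A)

/-- The Gabriel morphism with the given code, if there is one. -/
def gabrielHom (a b : κ.Obj) : κ.TripleCode →. GabrielHom C (κ.obj a) (κ.obj b) :=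
  fun ⟨k, l, i, m, q⟩ =>
    (κ.hom k a i).bind fun ι =>
    (κ.hom k l m).bind fun f =>
    (κ.hom b l q).bind fun j =>
    Part.assert (Mono ι ∧ Epi j) fun h =>
    have := h.1
    have := h.2
    let t : GenTriple (κ.obj a) (κ.obj b) :=
      { dom := κ.obj k, cod := κ.obj l, ι := ι, mid := f, j := j }
    Part.assert (t.IsGabriel C) fun ht => Part.some (GabrielHom.mk t ht)

/-- The data structure for a Serre quotient of `A`: the objects have the same codes as in `A`, and
the morphisms are coded by triples that represent Gabriel morphisms. -/
noncomputable def serreQuotient [C.IsSerreClass] {D : Type*} [Category* D] (Q : A ⥤ D)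
    [Q.IsLocalization C.isoModSerre] : Coding D where
  Obj := κ.Obj
  Mor := κ.TripleCode
  obj a := Q.obj (κ.obj a)
  hom a b c := (κ.gabrielHom C a b c).map (GabrielHom.toQuotient Q)

end Coding

end

-- The proof rests on two reductions, one algorithmic and one algebraic.
--
-- The algorithmic one: correctness is demanded only on admissible inputs and there is no bound on
-- running time, so blind search may replace explicit constructions. If a relation between inputs
-- and outputs is recursively enumerable, then enumerating candidates together with certificates
-- computes a correct output whenever one exists (`REPred.exists_choice`). A property is decided by
-- searching for a certificate of it or of its negation (`exists_decision`). So it suffices to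
-- express each task by conjunctions, disjunctions and existential quantifiers over codes. `REHom`
-- and `IsEffective.ex_hom` do this for equations between morphisms. Universal properties quantify
-- over all test objects and are not of this form; they are replaced by an isomorphism with a
-- computed kernel or cokernel, or by the biproduct equations. `IsEffective.isConstructivelyAbelian`
-- then leaves little to verify for the quotient: enumerable identities, composition, addition and
-- inequality, decidable membership, and computable kernels and cokernels.
--
-- The algebraic one: a triple represents `f` exactly if `Q(ι) f Q(j) = Q(mid)`, where `Q(ι)` and
-- `Q(j)` are invertible. Factoring the denominator of a fraction through its image and pushing out
-- along the epi part shows that every morphism of the quotient arises in this way. Since `Q` is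
-- exact, the kernel of `f` comes from that of `mid`, and dually for cokernels. Moreover `Q(d) = 0`
-- iff the image of `d` lies in `C`. For the difference `d` of two triples with equal images this
-- says that the kernel of `d` is large modulo `C`; restricting to it yields a common lower bound.
-- Hence the zeroid consists of the Gabriel morphisms with image zero.
--
-- The two meet in `IsConstructivelyAbelian.represents`: whether a coded Gabriel morphism agrees
-- with a fraction is an existential statement about `A`. Over a common denominator, the operations
-- on the quotient become operations on numerators in `A`, and the decidability of `C` makes both
-- `Q(d) = 0` and `Q(d) ≠ 0` enumerable.

attribute [fun_prop] Computable Computable.id Computable.const Computable.comp Computable.pair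
  Computable.fst Computable.snd Computable.encode Computable.decode
  Computable.unpair Computable.option_some

/-! ### Recursively enumerable relations and unbounded search. -/

section RecursivelyEnumerable

open Encodable
open Nat.Partrec (Code)

variable {α β : Type*} [Primcodable α] [Primcodable β]

theorem Computable.beq {f g : α → β} [DecidableEq β] (hf : Computable f) (hg : Computable g) :
    Computable fun x => decide (f x = g x) := by
  have := (Primrec.eq (α := β)).decide.to_comp.comp hf hg
  exact this.of_eq fun x => by simp

/-- The graph of a partial recursive function is the projection of a computable relation. -/
theorem Partrec.exists_computable {F : α →. β} (hF : Partrec F) :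
    ∃ e : α × ℕ → Option β, Computable e ∧ ∀ a b, b ∈ F a ↔ ∃ n, e (a, n) = some b := by
  obtain ⟨c, hc⟩ := Code.exists_code.1 hF
  -- The second argument bounds the evaluation of a program for `F`, so that every single query
  -- terminates.
  refine ⟨fun x => (Code.evaln x.2 c (encode x.1)).bind decode, ?_, fun a b => ?_⟩
  · refine Computable.option_bind ?_ (Computable.decode.comp Computable.snd).to₂
    exact Code.primrec_evaln.to_comp.comp
      ((Computable.snd.pair (Computable.const c)).pair (Computable.encode.comp Computable.fst))
  · have h (m : ℕ) : m ∈ c.eval (encode a) ↔ ∃ b ∈ F a, encode b = m := by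
      rw [hc]; simp
    constructor
    · intro hb
      obtain ⟨n, hn⟩ := Code.evaln_complete.1 ((h _).2 ⟨b, hb, rfl⟩)
      exact ⟨n, by simp [Option.mem_def.1 hn]⟩
    · rintro ⟨n, hn⟩
      obtain ⟨m, hm, hm'⟩ := Option.bind_eq_some_iff.1 hn
      obtain ⟨b', hb', rfl⟩ := (h m).1 (Code.evaln_sound hm)
      rw [encodek] at hm'
      exact Option.some_injective _ hm' ▸ hb'

theorem rePred_iff_exists_computable {p : α → Prop} :
    REPred p ↔ ∃ e : α × ℕ → Bool, Computable e ∧ ∀ a, p a ↔ ∃ n, e (a, n) = true := by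
  constructor
  · intro hp
    obtain ⟨e, he, h⟩ := Partrec.exists_computable hp
    refine ⟨fun x => (e x).isSome, Primrec.option_isSome.to_comp.comp he, fun a => ?_⟩
    have := h a ()
    rw [show p a ↔ ∃ n, e (a, n) = some () from by simpa using this]
    exact exists_congr fun n => by
      rw [Option.isSome_iff_exists]
      exact ⟨fun h => ⟨_, h⟩, fun ⟨_, h⟩ => h⟩
  · rintro ⟨e, he, h⟩
    have : Partrec fun a => Nat.rfind fun n => Part.some (e (a, n)) := Partrec.rfind he.partrec
    refine this.dom_re.of_eq fun a => ?_
    rw [h]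
    refine Nat.rfind_dom.trans ⟨fun ⟨n, hn, _⟩ => ⟨n, ?_⟩, fun ⟨n, hn⟩ => ⟨n, ?_, ?_⟩⟩
    · exact (Part.mem_some_iff.1 hn).symm
    · exact Part.mem_some_iff.2 hn.symm
    · intros; trivial

namespace REPred

theorem and {p q : α → Prop} (hp : REPred p) (hq : REPred q) : REPred fun a => p a ∧ q a := by
  rw [rePred_iff_exists_computable] at *
  obtain ⟨e, he, h⟩ := hp
  obtain ⟨e', he', h'⟩ := hq
  refine ⟨fun x => e (x.1, x.2.unpair.1) && e' (x.1, x.2.unpair.2), ?_, fun a => ?_⟩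
  · have u := Computable.unpair.comp (Computable.snd (α := α))
    exact Primrec.and.to_comp.comp
      (he.comp (Computable.fst.pair (Computable.fst.comp u)))
      (he'.comp (Computable.fst.pair (Computable.snd.comp u)))
  · rw [h, h']
    refine ⟨fun ⟨⟨n, hn⟩, ⟨m, hm⟩⟩ => ⟨Nat.pair n m, by simp [hn, hm]⟩, fun ⟨n, hn⟩ => ?_⟩
    rw [Bool.and_eq_true] at hn
    exact ⟨⟨_, hn.1⟩, ⟨_, hn.2⟩⟩

theorem or {p q : α → Prop} (hp : REPred p) (hq : REPred q) : REPred fun a => p a ∨ q a := by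
  rw [rePred_iff_exists_computable] at *
  obtain ⟨e, he, h⟩ := hp
  obtain ⟨e', he', h'⟩ := hq
  refine ⟨fun x => e x || e' x, Primrec.or.to_comp.comp he he', fun a => ?_⟩
  simp [h, h', exists_or]

/-- Dovetailing: the number `n` is a pair of a candidate output and the index of a certificate for
it. -/
theorem exists_enumeration {p : α → β → Prop} (hp : REPred fun x : α × β => p x.1 x.2) :
    ∃ e : α × ℕ → Option β, Computable e ∧ ∀ a b, p a b ↔ ∃ n, e (a, n) = some b := by
  obtain ⟨e, he, h⟩ := rePred_iff_exists_computable.1 hp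
  refine ⟨fun x => (decode (α := β) x.2.unpair.1).bind fun b =>
    bif e ((x.1, b), x.2.unpair.2) then some b else none, ?_, fun a b => ?_⟩
  · have hc : Computable fun y : (α × ℕ) × β =>
        bif e ((y.1.1, y.2), y.1.2.unpair.2) then some y.2 else none :=
      Computable.cond (he.comp (by fun_prop)) (by fun_prop) (by fun_prop)
    exact Computable.option_bind (by fun_prop) hc.to₂
  · rw [h (a, b)]
    constructor
    · rintro ⟨n, hn⟩
      exact ⟨Nat.pair (encode b) n, by simp [hn]⟩
    · rintro ⟨n, hn⟩
      obtain ⟨b', -, hb'⟩ := Option.bind_eq_some_iff.1 hn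
      cases hc : e ((a, b'), n.unpair.2) with
      | false => simp [hc] at hb'
      | true =>
        simp only [hc, cond_true, Option.some.injEq] at hb'
        exact ⟨_, hb' ▸ hc⟩

theorem ex {p : α → β → Prop} (hp : REPred fun x : α × β => p x.1 x.2) :
    REPred fun a => ∃ b, p a b := by
  obtain ⟨e, he, h⟩ := hp.exists_enumeration
  refine rePred_iff_exists_computable.2
    ⟨fun x => (e x).isSome, Primrec.option_isSome.to_comp.comp he, fun a => ?_⟩
  simp only [h, Option.isSome_iff_exists]
  exact exists_comm

theorem proj {p : α × β → Prop} (hp : REPred p) : REPred fun a => ∃ b, p (a, b) :=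
  ex hp

/-- A recursively enumerable relation has a partial recursive choice function. -/
theorem exists_choice {p : α → β → Prop} (hp : REPred fun x : α × β => p x.1 x.2) :
    ∃ F : α →. β, Partrec F ∧ ∀ a, (∃ b, p a b) → ∃ b ∈ F a, p a b := by
  obtain ⟨e, he, h⟩ := hp.exists_enumeration
  -- The candidate found first is returned; it depends on the enumeration and need not be the given
  -- `b`.
  refine ⟨fun a => Nat.rfindOpt fun n => e (a, n), Partrec.rfindOpt he, fun a ⟨b, hb⟩ => ?_⟩
  obtain ⟨n, hn⟩ := (h a b).1 hb
  have hd := (Nat.rfindOpt_dom (f := fun n => e (a, n))).2 ⟨n, b, hn⟩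
  refine ⟨_, Part.get_mem hd, ?_⟩
  obtain ⟨m, hm⟩ := Nat.rfindOpt_spec (Part.get_mem hd)
  exact (h _ _).2 ⟨m, hm⟩

theorem comp {p : β → Prop} (hp : REPred p) {g : α → β} (hg : Computable g) :
    REPred fun a => p (g a) :=
  Partrec.comp hp hg

theorem eq {f g : α → β} (hf : Computable f) (hg : Computable g) : REPred fun a => f a = g a := by
  classical
  exact (Computable.computablePred (p := fun a => f a = g a) (hf.beq hg)).to_re

end REPred

theorem Partrec.rePred_mem {γ : Type*} [Primcodable γ] {F : β →. γ} (hF : Partrec F) {f : α → β}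
    {g : α → γ} (hf : Computable f) (hg : Computable g) : REPred fun a => g a ∈ F (f a) := by
  classical
  obtain ⟨e, he, h⟩ := hF.exists_computable
  refine rePred_iff_exists_computable.2
    ⟨fun x => decide (e (f x.1, x.2) = some (g x.1)), Computable.beq ?_ ?_, fun a => ?_⟩
  · exact he.comp ((hf.comp Computable.fst).pair Computable.snd)
  · exact Computable.option_some.comp (hg.comp Computable.fst)
  · simp [h]

/-- A property and its negation, both recursively enumerable on the admissible inputs, can be
decided there. -/
theorem exists_decision {p : α → Prop} {q r : α → Prop} (hp : REPred p) (hq : REPred q)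
    (hpq : ∀ a, r a → (¬ p a ↔ q a)) :
    ∃ F : α →. Bool, Partrec F ∧ ∀ a, r a → ∃ b ∈ F a, b = true ↔ p a := by
  classical
  -- The search runs over truth values, each admitted only with a certificate of the corresponding
  -- property.
  obtain ⟨F, hF, h⟩ := REPred.exists_choice
    (p := fun (a : α) (b : Bool) => (p a ∧ b = true) ∨ (q a ∧ b = false))
    (((hp.comp (by fun_prop)).and (REPred.eq (by fun_prop) (by fun_prop))).or
      ((hq.comp (by fun_prop)).and (REPred.eq (by fun_prop) (by fun_prop))))
  refine ⟨F, hF, fun a ha => ?_⟩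
  have := hpq a ha
  obtain ⟨b, hb, hb'⟩ := h a (by
    by_cases hp : p a
    · exact ⟨true, Or.inl ⟨hp, rfl⟩⟩
    · exact ⟨false, Or.inr ⟨(hpq a ha).1 hp, rfl⟩⟩)
  refine ⟨b, hb, ?_⟩
  rcases hb' with ⟨h₁, rfl⟩ | ⟨h₁, rfl⟩
  · simpa
  · simpa using this.2 h₁

end RecursivelyEnumerable

/-! ### Families of morphisms whose codes can be enumerated. -/

namespace Coding

section Effective

variable {A : Type*} [Category* A] [Preadditive A]

/-- The morphism with a given code, or zero. -/
noncomputable def val (κ : Coding A) (a b : κ.Obj) (m : κ.Mor) : κ.obj a ⟶ κ.obj b :=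
  open Classical in if h : (κ.hom a b m).Dom then (κ.hom a b m).get h else 0

variable {κ : Coding A} {a b c : κ.Obj} {m n : κ.Mor}

theorem val_of_mem {f : κ.obj a ⟶ κ.obj b} (h : f ∈ κ.hom a b m) : κ.val a b m = f := by
  obtain ⟨hd, rfl⟩ := h
  simp [val, hd]

theorem val_of_not_dom (h : ¬ (κ.hom a b m).Dom) : κ.val a b m = 0 := by
  simp [val, h]

theorem val_mem (h : (κ.hom a b m).Dom) : κ.val a b m ∈ κ.hom a b m := by
  simpa [val, h] using Part.get_mem h

variable (κ) in
/-- The graphs of the basic operations on the morphisms of a preadditive category are recursively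
enumerable, and so is the inequality of two morphisms. -/
structure IsEffective : Prop where
  hom_complete : ∀ (a b) (f : κ.obj a ⟶ κ.obj b), ∃ c, f ∈ κ.hom a b c
  membership : ComputablePred fun x : κ.Obj × κ.Obj × κ.Mor => (κ.hom x.1 x.2.1 x.2.2).Dom
  identity : REPred fun x : κ.Obj × κ.Mor => 𝟙 (κ.obj x.1) ∈ κ.hom x.1 x.1 x.2
  composition : REPred fun x : κ.Obj × κ.Obj × κ.Obj × κ.Mor × κ.Mor × κ.Mor =>
    ∃ f ∈ κ.hom x.1 x.2.1 x.2.2.2.1, ∃ g ∈ κ.hom x.2.1 x.2.2.1 x.2.2.2.2.1,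
      f ≫ g ∈ κ.hom x.1 x.2.2.1 x.2.2.2.2.2
  addition : REPred fun x : κ.Obj × κ.Obj × κ.Mor × κ.Mor × κ.Mor =>
    ∃ f ∈ κ.hom x.1 x.2.1 x.2.2.1, ∃ g ∈ κ.hom x.1 x.2.1 x.2.2.2.1,
      f + g ∈ κ.hom x.1 x.2.1 x.2.2.2.2
  ne : REPred fun x : κ.Obj × κ.Obj × κ.Mor × κ.Mor =>
    ∃ f ∈ κ.hom x.1 x.2.1 x.2.2.1, ∃ g ∈ κ.hom x.1 x.2.1 x.2.2.2, f ≠ g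

variable {α : Type*} [Primcodable α]

variable (κ) in
/-- The codes of the members of a family of morphisms are recursively enumerable, uniformly in the
index. -/
structure REHom (a b : α → κ.Obj) (f : ∀ x, κ.obj (a x) ⟶ κ.obj (b x)) : Prop where
  source : Computable a
  target : Computable b
  codes : REPred fun z : α × κ.Mor => f z.1 ∈ κ.hom (a z.1) (b z.1) z.2

namespace REHom

variable {a b c : α → κ.Obj} {f g : ∀ x, κ.obj (a x) ⟶ κ.obj (b x)}

omit [Preadditive A] in
theorem codes_comp {β : Type*} [Primcodable β] (hf : κ.REHom a b f) {i : β → α} {m : β → κ.Mor}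
    (hi : Computable i) (hm : Computable m) :
    REPred fun y => f (i y) ∈ κ.hom (a (i y)) (b (i y)) (m y) :=
  hf.codes.comp (hi.pair hm)

omit [Preadditive A] in
theorem reindex {β : Type*} [Primcodable β] (hf : κ.REHom a b f) {i : β → α} (hi : Computable i) :
    κ.REHom (fun y => a (i y)) (fun y => b (i y)) fun y => f (i y) where
  source := hf.source.comp hi
  target := hf.target.comp hi
  codes := hf.codes_comp (i := fun z : β × κ.Mor => i z.1) (m := fun z => z.2) (by fun_prop)
    (by fun_prop)

theorem comp {h : ∀ x, κ.obj (b x) ⟶ κ.obj (c x)} (hκ : κ.IsEffective)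
    (hf : κ.REHom a b f) (hh : κ.REHom b c h) : κ.REHom a c fun x => f x ≫ h x where
  source := hf.source
  target := hh.target
  codes := by
    have ha := hf.source
    have hb := hf.target
    have hc := hh.target
    have := REPred.proj (REPred.proj (β := κ.Mor) (((hf.codes_comp
      (i := fun z : ((α × κ.Mor) × κ.Mor) × κ.Mor => z.1.1.1) (m := fun z => z.1.2)
      (by fun_prop) (by fun_prop)).and (hh.codes_comp
      (i := fun z : ((α × κ.Mor) × κ.Mor) × κ.Mor => z.1.1.1) (m := fun z => z.2)
      (by fun_prop) (by fun_prop))).and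
      (hκ.composition.comp (g := fun z : ((α × κ.Mor) × κ.Mor) × κ.Mor =>
        (a z.1.1.1, b z.1.1.1, c z.1.1.1, z.1.2, z.2, z.1.1.2)) (by fun_prop))))
    refine this.of_eq fun z => ⟨?_, fun hz => ?_⟩
    · rintro ⟨m, n, ⟨hm, hn⟩, f', hf', g', hg', H⟩
      rwa [Part.mem_unique hf' hm, Part.mem_unique hg' hn] at H
    · obtain ⟨m, hm⟩ := hκ.hom_complete _ _ (f z.1)
      obtain ⟨n, hn⟩ := hκ.hom_complete _ _ (h z.1)
      exact ⟨m, n, ⟨hm, hn⟩, _, hm, _, hn, hz⟩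

theorem add (hκ : κ.IsEffective) (hf : κ.REHom a b f) (hg : κ.REHom a b g) :
    κ.REHom a b fun x => f x + g x where
  source := hf.source
  target := hf.target
  codes := by
    have ha := hf.source
    have hb := hf.target
    have := REPred.proj (REPred.proj (β := κ.Mor) (((hf.codes_comp
      (i := fun z : ((α × κ.Mor) × κ.Mor) × κ.Mor => z.1.1.1) (m := fun z => z.1.2)
      (by fun_prop) (by fun_prop)).and (hg.codes_comp
      (i := fun z : ((α × κ.Mor) × κ.Mor) × κ.Mor => z.1.1.1) (m := fun z => z.2)
      (by fun_prop) (by fun_prop))).and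
      (hκ.addition.comp (g := fun z : ((α × κ.Mor) × κ.Mor) × κ.Mor =>
        (a z.1.1.1, b z.1.1.1, z.1.2, z.2, z.1.1.2)) (by fun_prop))))
    refine this.of_eq fun z => ⟨?_, fun hz => ?_⟩
    · rintro ⟨m, n, ⟨hm, hn⟩, f', hf', g', hg', H⟩
      rwa [Part.mem_unique hf' hm, Part.mem_unique hg' hn] at H
    · obtain ⟨m, hm⟩ := hκ.hom_complete _ _ (f z.1)
      obtain ⟨n, hn⟩ := hκ.hom_complete _ _ (g z.1)
      exact ⟨m, n, ⟨hm, hn⟩, _, hm, _, hn, hz⟩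

/-- Two morphisms are equal iff they share a code. This is where it matters that `REHom` enumerates
all codes of a morphism and not merely one of them. -/
theorem eq (hκ : κ.IsEffective) (hf : κ.REHom a b f) (hg : κ.REHom a b g) :
    REPred fun x => f x = g x := by
  refine (REPred.proj (hf.codes.and hg.codes)).of_eq fun x => ⟨?_, fun h => ?_⟩
  · rintro ⟨m, hm, hn⟩
    exact Part.mem_unique hm hn
  · obtain ⟨m, hm⟩ := hκ.hom_complete _ _ (f x)
    exact ⟨m, hm, h ▸ hm⟩

theorem ne (hκ : κ.IsEffective) (hf : κ.REHom a b f) (hg : κ.REHom a b g) :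
    REPred fun x => f x ≠ g x := by
  have ha := hf.source
  have hb := hf.target
  have := REPred.proj (REPred.proj (β := κ.Mor) (((hf.codes_comp
    (i := fun z : (α × κ.Mor) × κ.Mor => z.1.1) (m := fun z => z.1.2)
    (by fun_prop) (by fun_prop)).and (hg.codes_comp
    (i := fun z : (α × κ.Mor) × κ.Mor => z.1.1) (m := fun z => z.2)
    (by fun_prop) (by fun_prop))).and
    (hκ.ne.comp (g := fun z : (α × κ.Mor) × κ.Mor =>
      (a z.1.1, b z.1.1, z.1.2, z.2)) (by fun_prop))))
  refine this.of_eq fun x => ⟨?_, fun h => ?_⟩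
  · rintro ⟨m, n, ⟨hm, hn⟩, f', hf', g', hg', H⟩
    rwa [Part.mem_unique hf' hm, Part.mem_unique hg' hn] at H
  · obtain ⟨m, hm⟩ := hκ.hom_complete _ _ (f x)
    obtain ⟨n, hn⟩ := hκ.hom_complete _ _ (g x)
    exact ⟨m, n, ⟨hm, hn⟩, _, hm, _, hn, h⟩

/-- Zero is the only solution of `f + f = f`, so its codes are read off from the graph of addition.
-/
theorem zero (hκ : κ.IsEffective) (ha : Computable a) (hb : Computable b) :
    κ.REHom a b fun _ => 0 where
  source := ha
  target := hb
  codes := by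
    refine (hκ.addition.comp (g := fun z : α × κ.Mor => (a z.1, b z.1, z.2, z.2, z.2))
      (by fun_prop)).of_eq fun z => ⟨?_, fun hz => ⟨0, hz, 0, hz, by simpa using hz⟩⟩
    rintro ⟨f, hf, g, hg, h⟩
    have h₁ := Part.mem_unique hf h
    obtain rfl : g = 0 := by simpa using h₁
    exact hg

theorem id (hκ : κ.IsEffective) (ha : Computable a) : κ.REHom a a fun x => 𝟙 (κ.obj (a x)) where
  source := ha
  target := ha
  codes := hκ.identity.comp (g := fun z : α × κ.Mor => (a z.1, z.2)) (by fun_prop)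

/-- The graph of addition is read backwards: `h = f - g` iff `h + g = f`. -/
theorem sub (hκ : κ.IsEffective) (hf : κ.REHom a b f) (hg : κ.REHom a b g) :
    κ.REHom a b fun x => f x - g x where
  source := hf.source
  target := hf.target
  codes := by
    have ha := hf.source
    have hb := hf.target
    have := REPred.proj (REPred.proj (β := κ.Mor) (((hf.codes_comp
      (i := fun z : ((α × κ.Mor) × κ.Mor) × κ.Mor => z.1.1.1) (m := fun z => z.1.2)
      (by fun_prop) (by fun_prop)).and (hg.codes_comp
      (i := fun z : ((α × κ.Mor) × κ.Mor) × κ.Mor => z.1.1.1) (m := fun z => z.2)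
      (by fun_prop) (by fun_prop))).and
      (hκ.addition.comp (g := fun z : ((α × κ.Mor) × κ.Mor) × κ.Mor =>
        (a z.1.1.1, b z.1.1.1, z.1.1.2, z.2, z.1.2)) (by fun_prop))))
    refine this.of_eq fun z => ⟨?_, fun hz => ?_⟩
    · rintro ⟨m, n, ⟨hm, hn⟩, f', hf', g', hg', H⟩
      rw [Part.mem_unique hg' hn] at H
      rwa [Part.mem_unique hm H, add_sub_cancel_right]
    · obtain ⟨m, hm⟩ := hκ.hom_complete _ _ (f z.1)
      obtain ⟨n, hn⟩ := hκ.hom_complete _ _ (g z.1)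
      exact ⟨m, n, ⟨hm, hn⟩, _, hz, _, hn, by simpa using hm⟩

end REHom

namespace IsEffective

variable (hκ : κ.IsEffective)

include hκ

theorem mem_hom {a b : α → κ.Obj} {m : α → κ.Mor} (ha : Computable a := by fun_prop)
    (hb : Computable b := by fun_prop) (hm : Computable m := by fun_prop) :
    REPred fun x => (κ.hom (a x) (b x) (m x)).Dom :=
  hκ.membership.to_re.comp (g := fun x => (a x, b x, m x)) (by fun_prop)

/-- All codes of a morphism must be recovered from a single code `m`. They are the possible codes of
the composite of an identity with `m`. For an undefined code the value is the default zero;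
recognising that case needs membership to be decidable and not just enumerable. -/
theorem val {a b : α → κ.Obj} {m : α → κ.Mor} (ha : Computable a := by fun_prop)
    (hb : Computable b := by fun_prop) (hm : Computable m := by fun_prop) :
    κ.REHom a b fun x => κ.val (a x) (b x) (m x) where
  source := ha
  target := hb
  codes := by
    have h₁ := hκ.mem_hom (α := α × κ.Mor) (a := fun z => a z.1) (b := fun z => b z.1)
      (m := fun z => m z.1)
    have h₂ := hκ.membership.not.to_re.comp (g := fun z : α × κ.Mor => (a z.1, b z.1, m z.1))
      (by fun_prop)
    have h₃ : REPred fun z : α × κ.Mor => ∃ f ∈ κ.hom (a z.1) (b z.1) (m z.1),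
        f ∈ κ.hom (a z.1) (b z.1) z.2 := by
      have := REPred.proj (β := κ.Mor) ((hκ.identity.comp
        (g := fun z : (α × κ.Mor) × κ.Mor => (a z.1.1, z.2)) (by fun_prop)).and
        (hκ.composition.comp (g := fun z : (α × κ.Mor) × κ.Mor =>
          (a z.1.1, a z.1.1, b z.1.1, z.2, m z.1.1, z.1.2)) (by fun_prop)))
      refine this.of_eq fun z => ⟨?_, fun ⟨f, hf, hf'⟩ => ?_⟩
      · rintro ⟨e, he, i, hi, f, hf, h⟩
        rw [Part.mem_unique hi he, Category.id_comp] at h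
        exact ⟨f, hf, h⟩
      · obtain ⟨e, he⟩ := hκ.hom_complete _ _ (𝟙 (κ.obj (a z.1)))
        exact ⟨e, he, _, he, f, hf, by simpa using hf'⟩
    refine (h₃.or (h₂.and (REHom.zero hκ ha hb).codes)).of_eq fun z => ⟨?_, fun h => ?_⟩
    · rintro (⟨f, hf, hf'⟩ | ⟨h, h'⟩)
      · rwa [val_of_mem hf]
      · rwa [val_of_not_dom h]
    · by_cases hd : (κ.hom (a z.1) (b z.1) (m z.1)).Dom
      · exact Or.inl ⟨_, val_mem hd, h⟩
      · rw [val_of_not_dom hd] at h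
        exact Or.inr ⟨hd, h⟩

/-- An existential quantifier over morphisms becomes one over codes. Undefined codes do no harm,
because the default value zero is itself a morphism and hence a legitimate witness. -/
theorem ex_hom {a b : α → κ.Obj} {p : ∀ x, (κ.obj (a x) ⟶ κ.obj (b x)) → Prop}
    (hp : REPred fun z : α × κ.Mor => p z.1 (κ.val (a z.1) (b z.1) z.2)) :
    REPred fun x => ∃ f, p x f := by
  refine (REPred.ex (p := fun x m => p x (κ.val (a x) (b x) m)) hp).of_eq fun x =>
    ⟨fun ⟨m, hm⟩ => ⟨_, hm⟩, fun ⟨f, hf⟩ => ?_⟩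
  obtain ⟨m, hm⟩ := hκ.hom_complete _ _ f
  exact ⟨m, by rwa [val_of_mem hm]⟩

end IsEffective

end Effective

end Coding

/-! ### Kernels and cokernels as properties of a morphism, independent of choices. -/

namespace CategoryTheory

section

variable {A : Type*} [Category* A] [HasZeroMorphisms A]

/-- The morphism `i` is a kernel of `f`. -/
def IsKernel {K X Y : A} (i : K ⟶ X) (f : X ⟶ Y) : Prop :=
  i ≫ f = 0 ∧ ∀ ⦃T⦄ (t : T ⟶ X), t ≫ f = 0 → ∃! u, u ≫ i = t

/-- The morphism `e` is a cokernel of `f`. -/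
def IsCokernel {X Y K : A} (e : Y ⟶ K) (f : X ⟶ Y) : Prop :=
  f ≫ e = 0 ∧ ∀ ⦃T⦄ (t : Y ⟶ T), f ≫ t = 0 → ∃! u, e ≫ u = t

variable {K X Y : A}

theorem isKernel_kernel_ι (f : X ⟶ Y) [HasKernel f] : IsKernel (kernel.ι f) f :=
  ⟨kernel.condition f, fun _ t ht => ⟨kernel.lift f t ht, by simp, fun u hu => by
    rw [← cancel_mono (kernel.ι f), hu, kernel.lift_ι]⟩⟩

theorem isCokernel_cokernel_π (f : X ⟶ Y) [HasCokernel f] : IsCokernel (cokernel.π f) f :=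
  ⟨cokernel.condition f, fun _ t ht => ⟨cokernel.desc f t ht, by simp, fun u hu => by
    rw [← cancel_epi (cokernel.π f), hu, cokernel.π_desc]⟩⟩

theorem IsKernel.mono {i : K ⟶ X} {f : X ⟶ Y} (h : IsKernel i f) : Mono i where
  right_cancellation u v huv := by
    obtain ⟨w, -, hw⟩ := h.2 (v ≫ i) (by rw [Category.assoc, h.1, comp_zero])
    rw [hw u huv, hw v rfl]

theorem IsCokernel.epi {f : X ⟶ Y} {e : Y ⟶ K} (h : IsCokernel e f) : Epi e where
  left_cancellation u v huv := by
    obtain ⟨w, -, hw⟩ := h.2 (e ≫ v) (by rw [← Category.assoc, h.1, zero_comp])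
    rw [hw u huv, hw v rfl]

theorem isKernel_iff {i : K ⟶ X} {f : X ⟶ Y} :
    IsKernel i f ↔ ∃ w : i ≫ f = 0, Nonempty (IsLimit (KernelFork.ofι i w)) := by
  refine ⟨fun h => ⟨h.1, ⟨Fork.IsLimit.ofExistsUnique fun s => h.2 _ (KernelFork.condition s)⟩⟩,
    fun ⟨w, ⟨h⟩⟩ => ⟨w, fun T t ht => ?_⟩⟩
  have e : h.lift (KernelFork.ofι t ht) ≫ i = t := Fork.IsLimit.lift_ι h
  exact ⟨_, e, fun u hu => Fork.IsLimit.hom_ext h (hu.trans e.symm)⟩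

theorem isCokernel_iff {f : X ⟶ Y} {e : Y ⟶ K} :
    IsCokernel e f ↔ ∃ w : f ≫ e = 0, Nonempty (IsColimit (CokernelCofork.ofπ e w)) := by
  refine ⟨fun h => ⟨h.1, ⟨Cofork.IsColimit.ofExistsUnique fun s =>
    h.2 _ (CokernelCofork.condition s)⟩⟩,
    fun ⟨w, ⟨h⟩⟩ => ⟨w, fun T t ht => ?_⟩⟩
  have e' : e ≫ h.desc (CokernelCofork.ofπ t ht) = t := Cofork.IsColimit.π_desc h
  exact ⟨_, e', fun u hu => Cofork.IsColimit.hom_ext h (hu.trans e'.symm)⟩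

theorem IsKernel.exists_iso {K' : A} {i : K ⟶ X} {i' : K' ⟶ X} {f : X ⟶ Y} (h : IsKernel i f)
    (h' : IsKernel i' f) : ∃ e : K ≅ K', e.hom ≫ i' = i := by
  obtain ⟨u, hu, -⟩ := h'.2 i h.1
  obtain ⟨v, hv, -⟩ := h.2 i' h'.1
  have := h.mono
  have := h'.mono
  exact ⟨⟨u, v, by simp [← cancel_mono i, hu, hv], by simp [← cancel_mono i', hu, hv]⟩, hu⟩

theorem IsCokernel.exists_iso {K' : A} {e : Y ⟶ K} {e' : Y ⟶ K'} {f : X ⟶ Y} (h : IsCokernel e f)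
    (h' : IsCokernel e' f) : ∃ i : K ≅ K', e ≫ i.hom = e' := by
  obtain ⟨u, hu, -⟩ := h.2 e' h'.1
  obtain ⟨v, hv, -⟩ := h'.2 e h.1
  have := h.epi
  have := h'.epi
  exact ⟨⟨u, v, by simp [← cancel_epi e, reassoc_of% hu, hv],
    by simp [← cancel_epi e', reassoc_of% hv, hu]⟩, hu⟩

theorem IsKernel.iso_comp {K' : A} {i : K ⟶ X} {f : X ⟶ Y} (h : IsKernel i f) (e : K' ≅ K) :
    IsKernel (e.hom ≫ i) f := by
  refine ⟨by rw [Category.assoc, h.1, comp_zero], fun T t ht => ?_⟩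
  obtain ⟨u, hu, -⟩ := h.2 t ht
  have := h.mono
  exact ⟨u ≫ e.inv, by simp [hu], fun v hv => by
    rw [← cancel_mono (e.hom ≫ i), hv]; simp [hu]⟩

theorem IsCokernel.comp_iso {K' : A} {e : Y ⟶ K} {f : X ⟶ Y} (h : IsCokernel e f) (i : K ≅ K') :
    IsCokernel (e ≫ i.hom) f := by
  refine ⟨by rw [← Category.assoc, h.1, zero_comp], fun T t ht => ?_⟩
  obtain ⟨u, hu, -⟩ := h.2 t ht
  have := h.epi
  exact ⟨i.inv ≫ u, by simp [hu], fun v hv => by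
    rw [← cancel_epi (e ≫ i.hom), hv]; simp [hu]⟩

end

end CategoryTheory

/-! ### Constructively Abelian categories in terms of enumerable graphs. -/

namespace Coding

section Effective

variable {A : Type*} [Category* A]

theorem IsConstructivelyAbelian.isEffective [Abelian A] {κ : Coding A}
    (h : κ.IsConstructivelyAbelian) : κ.IsEffective := by
  have heq : REPred fun x : κ.Obj × κ.Obj × κ.Mor × κ.Mor =>
      ∃ f ∈ κ.hom x.1 x.2.1 x.2.2.1, f ∈ κ.hom x.1 x.2.1 x.2.2.2 := by
    obtain ⟨F, hF, hF'⟩ := h.equality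
    refine (((h.membership.to_re.comp (g := fun x : κ.Obj × κ.Obj × κ.Mor × κ.Mor =>
      (x.1, x.2.1, x.2.2.1)) (by fun_prop)).and (h.membership.to_re.comp
      (g := fun x : κ.Obj × κ.Obj × κ.Mor × κ.Mor => (x.1, x.2.1, x.2.2.2)) (by fun_prop))).and
      (hF.rePred_mem (f := fun x => x) (g := fun _ => true) (by fun_prop) (by fun_prop))).of_eq
      fun x => ⟨fun ⟨⟨hm, hn⟩, hr⟩ => ?_, fun ⟨f, hf, hf'⟩ => ⟨⟨hf.1, hf'.1⟩, ?_⟩⟩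
    · obtain ⟨r, hr', H⟩ := hF' _ _ _ _ _ (val_mem hm) _ (val_mem hn)
      have := H.1 (Part.mem_unique hr' hr)
      exact ⟨_, val_mem hm, this ▸ val_mem hn⟩
    · obtain ⟨r, hr', H⟩ := hF' _ _ _ _ _ hf _ hf'
      exact H.2 rfl ▸ hr'
  -- An algorithm outputs one code of the result; comparing it with arbitrary codes by `heq`
  -- enumerates all of them.
  have key {β : Type} [Primcodable β] {F : β →. κ.Mor} (hF : Partrec F) {a b : β → κ.Obj}
      (ha : Computable a) (hb : Computable b) : REPred fun z : β × κ.Mor =>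
        ∃ c ∈ F z.1, ∃ f ∈ κ.hom (a z.1) (b z.1) c, f ∈ κ.hom (a z.1) (b z.1) z.2 :=
    REPred.proj ((hF.rePred_mem (f := fun z : (β × κ.Mor) × κ.Mor => z.1.1) (g := fun z => z.2)
      (by fun_prop) (by fun_prop)).and (heq.comp (g := fun z : (β × κ.Mor) × κ.Mor =>
      (a z.1.1, b z.1.1, z.2, z.1.2)) (by fun_prop)))
  have key' {β : Type} [Primcodable β] {F : β →. κ.Mor} {a b : β → κ.Obj} {x : β}
      {f : κ.obj (a x) ⟶ κ.obj (b x)} (H : κ.Outputs (F x) (a x) (b x) fun h => h = f) {p : κ.Mor} :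
      (∃ c ∈ F x, ∃ f ∈ κ.hom (a x) (b x) c, f ∈ κ.hom (a x) (b x) p) ↔
        f ∈ κ.hom (a x) (b x) p := by
    obtain ⟨c, hc, f, hf, rfl⟩ := H
    refine ⟨fun ⟨c', hc', f', hf', hp⟩ => ?_, fun hp => ⟨c, hc, f, hf, hp⟩⟩
    obtain rfl := Part.mem_unique hc' hc
    rwa [Part.mem_unique hf hf']
  refine ⟨h.hom_complete, h.membership, ?_, ?_, ?_, ?_⟩
  · obtain ⟨F, hF, hF'⟩ := h.identity
    exact (key hF (a := fun x => x) (b := fun x => x) (by fun_prop) (by fun_prop)).of_eq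
      fun z => key' (a := fun x => x) (b := fun x => x) (hF' z.1)
  · obtain ⟨F, hF, hF'⟩ := h.composition
    let a : κ.Obj × κ.Obj × κ.Obj × κ.Mor × κ.Mor → κ.Obj := fun x => x.1
    let b : κ.Obj × κ.Obj × κ.Obj × κ.Mor × κ.Mor → κ.Obj := fun x => x.2.2.1
    refine (((h.membership.to_re.comp
      (g := fun x : κ.Obj × κ.Obj × κ.Obj × κ.Mor × κ.Mor × κ.Mor =>
        (x.1, x.2.1, x.2.2.2.1)) (by fun_prop)).and (h.membership.to_re.comp
      (g := fun x : κ.Obj × κ.Obj × κ.Obj × κ.Mor × κ.Mor × κ.Mor =>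
        (x.2.1, x.2.2.1, x.2.2.2.2.1)) (by fun_prop))).and
      ((key hF (a := a) (b := b) (by fun_prop) (by fun_prop)).comp
        (g := fun x : κ.Obj × κ.Obj × κ.Obj × κ.Mor × κ.Mor × κ.Mor =>
        ((x.1, x.2.1, x.2.2.1, x.2.2.2.1, x.2.2.2.2.1), x.2.2.2.2.2)) (by fun_prop))).of_eq
      fun x => ⟨fun ⟨⟨hm, hn⟩, hr⟩ => ?_, fun ⟨f, hf, g, hg, hr⟩ => ⟨⟨hf.1, hg.1⟩, ?_⟩⟩
    · exact ⟨_, val_mem hm, _, val_mem hn, (key' (a := a) (b := b)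
        (hF' _ _ _ _ _ _ (val_mem hm) _ (val_mem hn))).1 hr⟩
    · exact (key' (a := a) (b := b) (hF' _ _ _ _ _ _ hf _ hg)).2 hr
  · obtain ⟨F, hF, hF'⟩ := h.addition
    let a : κ.Obj × κ.Obj × κ.Mor × κ.Mor → κ.Obj := fun x => x.1
    let b : κ.Obj × κ.Obj × κ.Mor × κ.Mor → κ.Obj := fun x => x.2.1
    refine (((h.membership.to_re.comp
      (g := fun x : κ.Obj × κ.Obj × κ.Mor × κ.Mor × κ.Mor =>
        (x.1, x.2.1, x.2.2.1)) (by fun_prop)).and (h.membership.to_re.comp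
      (g := fun x : κ.Obj × κ.Obj × κ.Mor × κ.Mor × κ.Mor =>
        (x.1, x.2.1, x.2.2.2.1)) (by fun_prop))).and
      ((key hF (a := a) (b := b) (by fun_prop) (by fun_prop)).comp
        (g := fun x : κ.Obj × κ.Obj × κ.Mor × κ.Mor × κ.Mor =>
        ((x.1, x.2.1, x.2.2.1, x.2.2.2.1), x.2.2.2.2)) (by fun_prop))).of_eq
      fun x => ⟨fun ⟨⟨hm, hn⟩, hr⟩ => ?_, fun ⟨f, hf, g, hg, hr⟩ => ⟨⟨hf.1, hg.1⟩, ?_⟩⟩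
    · exact ⟨_, val_mem hm, _, val_mem hn, (key' (a := a) (b := b)
        (hF' _ _ _ _ _ (val_mem hm) _ (val_mem hn))).1 hr⟩
    · exact (key' (a := a) (b := b) (hF' _ _ _ _ _ hf _ hg)).2 hr
  · obtain ⟨F, hF, hF'⟩ := h.equality
    refine (((h.membership.to_re.comp (g := fun x : κ.Obj × κ.Obj × κ.Mor × κ.Mor =>
      (x.1, x.2.1, x.2.2.1)) (by fun_prop)).and (h.membership.to_re.comp
      (g := fun x : κ.Obj × κ.Obj × κ.Mor × κ.Mor => (x.1, x.2.1, x.2.2.2)) (by fun_prop))).and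
      (hF.rePred_mem (f := fun x => x) (g := fun _ => false) (by fun_prop) (by fun_prop))).of_eq
      fun x => ⟨fun ⟨⟨hm, hn⟩, hr⟩ => ?_, fun ⟨f, hf, g, hg, hne⟩ => ⟨⟨hf.1, hg.1⟩, ?_⟩⟩
    · refine ⟨_, val_mem hm, _, val_mem hn, fun e => ?_⟩
      obtain ⟨r, hr', H⟩ := hF' _ _ _ _ _ (val_mem hm) _ (val_mem hn)
      cases Part.mem_unique hr' hr
      exact Bool.noConfusion (H.2 e)
    · obtain ⟨r, hr', H⟩ := hF' _ _ _ _ _ hf _ hg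
      cases r
      · exact hr'
      · exact absurd (H.1 rfl) hne

end Effective

end Coding

namespace Coding

section Effective

variable {A : Type*} [Category* A]

theorem Outputs.imp {κ : Coding A} {x : Part κ.Mor} {a b : κ.Obj}
    {p q : (κ.obj a ⟶ κ.obj b) → Prop} (h : κ.Outputs x a b p) (hpq : ∀ f, p f → q f) :
    κ.Outputs x a b q :=
  let ⟨c, hc, f, hf, hp⟩ := h
  ⟨c, hc, f, hf, hpq f hp⟩

theorem Outputs.unique {κ : Coding A} {x : Part κ.Mor} {a b : κ.Obj}
    {p q : (κ.obj a ⟶ κ.obj b) → Prop} (h : κ.Outputs x a b p) (hpq : ∀ f, p f → q f)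
    (hq : ∃! f, q f) : κ.OutputsUnique x a b q :=
  h.imp fun f hf => ⟨hpq f hf, fun _ hf' => hq.unique hf' (hpq f hf)⟩

theorem IsEffective.exists_algorithm [Preadditive A] {κ : Coding A} (hκ : κ.IsEffective)
    {β : Type*} [Primcodable β] {a b : β → κ.Obj} {p : ∀ x, (κ.obj (a x) ⟶ κ.obj (b x)) → Prop}
    (hp : REPred fun z : β × κ.Mor => p z.1 (κ.val (a z.1) (b z.1) z.2))
    (ha : Computable a := by fun_prop) (hb : Computable b := by fun_prop) :
    ∃ F : β →. κ.Mor, Partrec F ∧ ∀ x, (∃ f, p x f) → κ.Outputs (F x) (a x) (b x) (p x) := by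
  -- Definedness is part of the search condition: otherwise an undefined code could be returned
  -- because its default value zero satisfies `p`.
  obtain ⟨F, hF, h⟩ := REPred.exists_choice (p := fun (x : β) (m : κ.Mor) =>
    (κ.hom (a x) (b x) m).Dom ∧ p x (κ.val (a x) (b x) m)) (hκ.mem_hom.and hp)
  refine ⟨F, hF, fun x ⟨f, hf⟩ => ?_⟩
  obtain ⟨m, hm⟩ := hκ.hom_complete _ _ f
  obtain ⟨c, hc, hd, hp⟩ := h x ⟨m, hm.1, by rwa [val_of_mem hm]⟩
  exact ⟨c, hc, _, val_mem hd, hp⟩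

section Kernels

variable [Abelian A] {κ : Coding A} (hκ : κ.IsConstructivelyAbelian) {α : Type*} [Primcodable α]
  {a b k : α → κ.Obj} {f : ∀ x, κ.obj (a x) ⟶ κ.obj (b x)}

include hκ

/-- The universal property is not visibly enumerable. But `i` is a kernel of `f` iff an isomorphism
identifies it with the computed kernel, and such an isomorphism and its inverse can be searched for.
-/
theorem IsConstructivelyAbelian.isKernel {i : ∀ x, κ.obj (k x) ⟶ κ.obj (a x)}
    (hf : κ.REHom a b f) (hi : κ.REHom k a i) : REPred fun x => IsKernel (i x) (f x) := by
  have hE := hκ.isEffective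
  obtain ⟨K, F, hK, -, H⟩ := hκ.kernels
  have ha := hf.source
  have hb := hf.target
  have hk := hi.source
  have : REPred fun x => ∃ m, ∃ y : κ.Obj × κ.Mor, f x ∈ κ.hom (a x) (b x) m ∧
      y ∈ K (a x, b x, m) ∧ ∃ u : κ.obj (k x) ⟶ κ.obj y.1, ∃ v : κ.obj y.1 ⟶ κ.obj (k x),
      (u ≫ v = 𝟙 _ ∧ v ≫ u = 𝟙 _) ∧ u ≫ κ.val y.1 (a x) y.2 = i x := by
    refine REPred.ex <| REPred.ex <| (hf.codes_comp (by fun_prop) (by fun_prop)).and <|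
      (hK.rePred_mem (by fun_prop) (by fun_prop)).and <| hE.ex_hom <| hE.ex_hom <|
      ((REHom.eq hE (.comp hE hE.val hE.val) (.id hE (by fun_prop))).and
      (REHom.eq hE (.comp hE hE.val hE.val) (.id hE (by fun_prop)))).and
      (REHom.eq hE (.comp hE hE.val hE.val) (hi.reindex (by fun_prop)))
  -- The algorithm guarantees lifts from coded test objects only; every other test object is
  -- isomorphic to a coded one.
  have hker {a b : κ.Obj} {m : κ.Mor} {f : κ.obj a ⟶ κ.obj b} (hf : f ∈ κ.hom a b m) :
      ∃ y ∈ K (a, b, m), (κ.hom y.1 a y.2).Dom ∧ IsKernel (κ.val y.1 a y.2) f := by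
    obtain ⟨k, n, hkn, i, hi, w, hl⟩ := H _ _ _ _ hf
    refine ⟨_, hkn, hi.1, ?_⟩
    rw [val_of_mem hi]
    refine ⟨w, fun T t ht => ?_⟩
    obtain ⟨l, ⟨e⟩⟩ := hκ.obj_complete T
    obtain ⟨q, hq⟩ := hκ.hom_complete _ _ (e.hom ≫ t)
    obtain ⟨c, -, u, -, hu, hu'⟩ := hl l q _ hq (by simp [ht])
    refine ⟨e.inv ≫ u, by simp [hu], fun v hv => ?_⟩
    rw [← hu' (e.hom ≫ v) (by simp [hv]), Iso.inv_hom_id_assoc]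
  refine this.of_eq fun x => ⟨?_, fun h => ?_⟩
  · rintro ⟨m, y, hm, hy, u, v, ⟨h₁, h₂⟩, h₃⟩
    obtain ⟨y', hy', -, hi⟩ := hker hm
    obtain rfl := Part.mem_unique hy' hy
    exact h₃ ▸ hi.iso_comp ⟨u, v, h₁, h₂⟩
  · obtain ⟨m, hm⟩ := hκ.hom_complete _ _ (f x)
    obtain ⟨y, hy, -, hi⟩ := hker hm
    obtain ⟨e, he⟩ := h.exists_iso hi
    exact ⟨m, y, hm, hy, e.hom, e.inv, ⟨e.hom_inv_id, e.inv_hom_id⟩, he⟩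

theorem IsConstructivelyAbelian.isCokernel {e : ∀ x, κ.obj (b x) ⟶ κ.obj (k x)}
    (hf : κ.REHom a b f) (he : κ.REHom b k e) : REPred fun x => IsCokernel (e x) (f x) := by
  have hE := hκ.isEffective
  obtain ⟨K, F, hK, -, H⟩ := hκ.cokernels
  have ha := hf.source
  have hb := hf.target
  have hk := he.target
  have : REPred fun x => ∃ m, ∃ y : κ.Obj × κ.Mor, f x ∈ κ.hom (a x) (b x) m ∧
      y ∈ K (a x, b x, m) ∧ ∃ u : κ.obj y.1 ⟶ κ.obj (k x), ∃ v : κ.obj (k x) ⟶ κ.obj y.1,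
      (u ≫ v = 𝟙 _ ∧ v ≫ u = 𝟙 _) ∧ κ.val (b x) y.1 y.2 ≫ u = e x := by
    refine REPred.ex <| REPred.ex <| (hf.codes_comp (by fun_prop) (by fun_prop)).and <|
      (hK.rePred_mem (by fun_prop) (by fun_prop)).and <| hE.ex_hom <| hE.ex_hom <|
      ((REHom.eq hE (.comp hE hE.val hE.val) (.id hE (by fun_prop))).and
      (REHom.eq hE (.comp hE hE.val hE.val) (.id hE (by fun_prop)))).and
      (REHom.eq hE (.comp hE hE.val hE.val) (he.reindex (by fun_prop)))
  have hcoker {a b : κ.Obj} {m : κ.Mor} {f : κ.obj a ⟶ κ.obj b} (hf : f ∈ κ.hom a b m) :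
      ∃ y ∈ K (a, b, m), (κ.hom b y.1 y.2).Dom ∧ IsCokernel (κ.val b y.1 y.2) f := by
    obtain ⟨k, n, hkn, e, he, w, hl⟩ := H _ _ _ _ hf
    refine ⟨_, hkn, he.1, ?_⟩
    rw [val_of_mem he]
    refine ⟨w, fun T t ht => ?_⟩
    obtain ⟨l, ⟨i⟩⟩ := hκ.obj_complete T
    obtain ⟨q, hq⟩ := hκ.hom_complete _ _ (t ≫ i.inv)
    obtain ⟨c, -, u, -, hu, hu'⟩ := hl l q _ hq (by simp [reassoc_of% ht])
    refine ⟨u ≫ i.hom, by simp [reassoc_of% hu], fun v hv => ?_⟩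
    rw [← hu' (v ≫ i.inv) (by simp [reassoc_of% hv])]
    simp
  refine this.of_eq fun x => ⟨?_, fun h => ?_⟩
  · rintro ⟨m, y, hm, hy, u, v, ⟨h₁, h₂⟩, h₃⟩
    obtain ⟨y', hy', -, hi⟩ := hcoker hm
    obtain rfl := Part.mem_unique hy' hy
    exact h₃ ▸ hi.comp_iso ⟨u, v, h₁, h₂⟩
  · obtain ⟨m, hm⟩ := hκ.hom_complete _ _ (f x)
    obtain ⟨y, hy, -, hi⟩ := hcoker hm
    obtain ⟨i, hi'⟩ := hi.exists_iso h
    exact ⟨m, y, hm, hy, i.hom, i.inv, ⟨i.hom_inv_id, i.inv_hom_id⟩, hi'⟩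

end Kernels

/-- If the operations of an Abelian category have recursively enumerable graphs and if kernels and
cokernels are computable, then all further existential statements can be realised by searching. -/
theorem IsEffective.isConstructivelyAbelian [Abelian A] {κ : Coding A} (hE : κ.IsEffective)
    (hobj : ∀ X : A, ∃ a, Nonempty (κ.obj a ≅ X))
    (hker : ∃ K : κ.Obj × κ.Obj × κ.Mor →. κ.Obj × κ.Mor, Partrec K ∧
      ∀ a b m, ∀ f ∈ κ.hom a b m, ∃ k n, (k, n) ∈ K (a, b, m) ∧ ∃ i ∈ κ.hom k a n, IsKernel i f)
    (hcoker : ∃ K : κ.Obj × κ.Obj × κ.Mor →. κ.Obj × κ.Mor, Partrec K ∧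
      ∀ a b m, ∀ f ∈ κ.hom a b m, ∃ k n, (k, n) ∈ K (a, b, m) ∧
        ∃ e ∈ κ.hom b k n, IsCokernel e f) :
    κ.IsConstructivelyAbelian where
  obj_complete := hobj
  hom_complete := hE.hom_complete
  identity := by
    obtain ⟨F, hF, h⟩ := hE.exists_algorithm (β := κ.Obj) (a := fun x => x) (b := fun x => x)
      (p := fun x f => f = 𝟙 (κ.obj x)) (REHom.eq hE hE.val (.id hE (by fun_prop)))
    exact ⟨F, hF, fun a => h a ⟨_, rfl⟩⟩
  composition := by
    obtain ⟨F, hF, h⟩ := hE.exists_algorithm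
      (β := κ.Obj × κ.Obj × κ.Obj × κ.Mor × κ.Mor) (a := fun x => x.1) (b := fun x => x.2.2.1)
      (p := fun x f => f = κ.val x.1 x.2.1 x.2.2.2.1 ≫ κ.val x.2.1 x.2.2.1 x.2.2.2.2)
      (REHom.eq hE hE.val (.comp hE hE.val hE.val))
    refine ⟨F, hF, fun a b c m n f hf g hg => (h (a, b, c, m, n) ⟨_, rfl⟩).imp ?_⟩
    rintro _ rfl
    simp only [val_of_mem hf, val_of_mem hg]
  membership := hE.membership
  equality := by
    obtain ⟨F, hF, h⟩ := exists_decision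
      (p := fun x : κ.Obj × κ.Obj × κ.Mor × κ.Mor =>
        κ.val x.1 x.2.1 x.2.2.1 = κ.val x.1 x.2.1 x.2.2.2) (r := fun _ => True)
      (REHom.eq hE hE.val hE.val) (REHom.ne hE hE.val hE.val) fun _ _ => Iff.rfl
    refine ⟨F, hF, fun a b m n f hf g hg => ?_⟩
    simpa only [val_of_mem hf, val_of_mem hg] using h (a, b, m, n) trivial
  addition := by
    obtain ⟨F, hF, h⟩ := hE.exists_algorithm
      (β := κ.Obj × κ.Obj × κ.Mor × κ.Mor) (a := fun x => x.1) (b := fun x => x.2.1)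
      (p := fun x f => f = κ.val x.1 x.2.1 x.2.2.1 + κ.val x.1 x.2.1 x.2.2.2)
      (REHom.eq hE hE.val (.add hE hE.val hE.val))
    refine ⟨F, hF, fun a b m n f hf g hg => (h (a, b, m, n) ⟨_, rfl⟩).imp ?_⟩
    rintro _ rfl
    simp only [val_of_mem hf, val_of_mem hg]
  subtraction := by
    obtain ⟨F, hF, h⟩ := hE.exists_algorithm
      (β := κ.Obj × κ.Obj × κ.Mor × κ.Mor) (a := fun x => x.1) (b := fun x => x.2.1)
      (p := fun x f => f = κ.val x.1 x.2.1 x.2.2.1 - κ.val x.1 x.2.1 x.2.2.2)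
      (REHom.eq hE hE.val (.sub hE hE.val hE.val))
    refine ⟨F, hF, fun a b m n f hf g hg => (h (a, b, m, n) ⟨_, rfl⟩).imp ?_⟩
    rintro _ rfl
    simp only [val_of_mem hf, val_of_mem hg]
  zeroMorphism := by
    obtain ⟨F, hF, h⟩ := hE.exists_algorithm (β := κ.Obj × κ.Obj) (a := fun x => x.1)
      (b := fun x => x.2) (p := fun x f => f = 0)
      (REHom.eq hE hE.val (.zero hE (by fun_prop) (by fun_prop)))
    exact ⟨F, hF, fun a b => h (a, b) ⟨_, rfl⟩⟩
  zeroObject := by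
    obtain ⟨X, hX⟩ := HasZeroObject.zero (C := A)
    obtain ⟨z, ⟨e⟩⟩ := hobj X
    exact ⟨z, hX.of_iso e⟩
  product := by
    -- The universal property of the product is certified by the two inclusions and the finitely
    -- many equations of a biproduct.
    obtain ⟨P, hP, h⟩ := REPred.exists_choice
      (p := fun (x : κ.Obj × κ.Obj) (y : κ.Obj × κ.Mor × κ.Mor) =>
        ((κ.hom y.1 x.1 y.2.1).Dom ∧ (κ.hom y.1 x.2 y.2.2).Dom) ∧
        ∃ i : κ.obj x.1 ⟶ κ.obj y.1, ∃ j : κ.obj x.2 ⟶ κ.obj y.1,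
          (i ≫ κ.val y.1 x.1 y.2.1 = 𝟙 _ ∧ i ≫ κ.val y.1 x.2 y.2.2 = 0) ∧
          (j ≫ κ.val y.1 x.1 y.2.1 = 0 ∧ j ≫ κ.val y.1 x.2 y.2.2 = 𝟙 _) ∧
          κ.val y.1 x.1 y.2.1 ≫ i + κ.val y.1 x.2 y.2.2 ≫ j = 𝟙 _) (by
      refine (hE.mem_hom.and hE.mem_hom).and <| hE.ex_hom <| hE.ex_hom <|
        ((REHom.eq hE (.comp hE hE.val hE.val) (.id hE (by fun_prop))).and
        (REHom.eq hE (.comp hE hE.val hE.val) (.zero hE (by fun_prop) (by fun_prop)))).and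
        (((REHom.eq hE (.comp hE hE.val hE.val) (.zero hE (by fun_prop) (by fun_prop))).and
        (REHom.eq hE (.comp hE hE.val hE.val) (.id hE (by fun_prop)))).and
        (REHom.eq hE (.add hE (.comp hE hE.val hE.val) (.comp hE hE.val hE.val))
          (.id hE (by fun_prop)))))
    -- The product is not among the inputs of the pairing. It is recovered as the output of `P`,
    -- which is single-valued, so both algorithms refer to the same product. Lifts along kernels and
    -- colifts along cokernels use the same device.
    obtain ⟨F, hF, h'⟩ := REPred.exists_choice
      (p := fun (x : κ.Obj × κ.Obj × κ.Obj × κ.Mor × κ.Mor) (u : κ.Mor) =>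
        ∃ y : κ.Obj × κ.Mor × κ.Mor, y ∈ P (x.1, x.2.1) ∧ (κ.hom x.2.2.1 y.1 u).Dom ∧
        κ.val x.2.2.1 y.1 u ≫ κ.val y.1 x.1 y.2.1 = κ.val x.2.2.1 x.1 x.2.2.2.1 ∧
        κ.val x.2.2.1 y.1 u ≫ κ.val y.1 x.2.1 y.2.2 = κ.val x.2.2.1 x.2.1 x.2.2.2.2) (by
      refine REPred.ex <| (hP.rePred_mem (by fun_prop) (by fun_prop)).and <| hE.mem_hom.and <|
        (REHom.eq hE (.comp hE hE.val hE.val) hE.val).and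
        (REHom.eq hE (.comp hE hE.val hE.val) hE.val))
    refine ⟨P, F, hP, hF, fun a₁ a₂ => ?_⟩
    obtain ⟨⟨p, m₁, m₂⟩, hy, ⟨hm₁, hm₂⟩, i, j, ⟨h₁, h₂⟩, ⟨h₃, h₄⟩, h₅⟩ := h (a₁, a₂) (by
      obtain ⟨p, ⟨e⟩⟩ := hobj (κ.obj a₁ ⊞ κ.obj a₂)
      obtain ⟨m₁, hm₁⟩ := hE.hom_complete _ _ (e.hom ≫ biprod.fst)
      obtain ⟨m₂, hm₂⟩ := hE.hom_complete _ _ (e.hom ≫ biprod.snd)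
      refine ⟨(p, m₁, m₂), ⟨hm₁.1, hm₂.1⟩, biprod.inl ≫ e.inv, biprod.inr ≫ e.inv, ?_⟩
      simp only [val_of_mem hm₁, val_of_mem hm₂]
      simp only [Category.assoc, Iso.inv_hom_id_assoc, biprod.inl_fst, biprod.inl_snd,
        biprod.inr_fst, biprod.inr_snd, and_self, true_and]
      rw [← Preadditive.comp_add, ← Category.assoc, ← Category.assoc, ← Preadditive.add_comp,
        biprod.total, Category.id_comp, e.hom_inv_id])
    dsimp only at hm₁ hm₂ i j h₁ h₂ h₃ h₄ h₅
    refine ⟨p, m₁, m₂, hy, _, val_mem hm₁, _, val_mem hm₂, fun l n₁ n₂ f₁ hf₁ f₂ hf₂ => ?_⟩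
    have huniq : ∃! u : κ.obj l ⟶ κ.obj p,
        u ≫ κ.val p a₁ m₁ = f₁ ∧ u ≫ κ.val p a₂ m₂ = f₂ := by
      refine ⟨f₁ ≫ i + f₂ ≫ j, by simp [h₁, h₂, h₃, h₄], ?_⟩
      rintro u ⟨rfl, rfl⟩
      rw [Category.assoc, Category.assoc, ← Preadditive.comp_add, h₅, Category.comp_id]
    obtain ⟨u, ⟨hu₁, hu₂⟩, -⟩ := id huniq
    obtain ⟨c, hc⟩ := hE.hom_complete _ _ u
    obtain ⟨c', hc', y, hy', hd, h₆, h₇⟩ := h' (a₁, a₂, l, n₁, n₂) ⟨c, _, hy, hc.1, by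
      simpa only [val_of_mem hc, val_of_mem hf₁, val_of_mem hf₂] using ⟨hu₁, hu₂⟩⟩
    obtain rfl := Part.mem_unique hy' hy
    refine Outputs.unique (p := fun v => v ≫ κ.val p a₁ m₁ = f₁ ∧ v ≫ κ.val p a₂ m₂ = f₂)
      ⟨c', hc', _, val_mem hd, ?_⟩ (fun _ h => h) huniq
    simpa only [val_of_mem hf₁, val_of_mem hf₂] using And.intro h₆ h₇
  kernels := by
    obtain ⟨K, hK, h⟩ := hker
    obtain ⟨F, hF, h'⟩ := REPred.exists_choice
      (p := fun (x : κ.Obj × κ.Obj × κ.Mor × κ.Obj × κ.Mor) (u : κ.Mor) =>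
        ∃ y : κ.Obj × κ.Mor, y ∈ K (x.1, x.2.1, x.2.2.1) ∧ (κ.hom x.2.2.2.1 y.1 u).Dom ∧
        κ.val x.2.2.2.1 y.1 u ≫ κ.val y.1 x.1 y.2 = κ.val x.2.2.2.1 x.1 x.2.2.2.2) (by
      refine REPred.ex <| (hK.rePred_mem (by fun_prop) (by fun_prop)).and <| hE.mem_hom.and <|
        REHom.eq hE (.comp hE hE.val hE.val) hE.val)
    refine ⟨K, F, hK, hF, fun a b m f hf => ?_⟩
    obtain ⟨k, n, hy, i, hi, hif⟩ := h a b m f hf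
    refine ⟨k, n, hy, i, hi, hif.1, fun l q t ht htf => ?_⟩
    obtain ⟨u, hu, -⟩ := hif.2 t htf
    obtain ⟨c, hc⟩ := hE.hom_complete _ _ u
    obtain ⟨c', hc', y, hy', hd, h₆⟩ := h' (a, b, m, l, q) ⟨c, _, hy, hc.1, by
      simpa only [val_of_mem hc, val_of_mem hi, val_of_mem ht] using hu⟩
    obtain rfl := Part.mem_unique hy' hy
    refine Outputs.unique (p := fun v => v ≫ i = t) ⟨c', hc', _, val_mem hd, ?_⟩ (fun _ h => h)
      (hif.2 t htf)
    simpa only [val_of_mem hi, val_of_mem ht] using h₆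
  cokernels := by
    obtain ⟨K, hK, h⟩ := hcoker
    obtain ⟨F, hF, h'⟩ := REPred.exists_choice
      (p := fun (x : κ.Obj × κ.Obj × κ.Mor × κ.Obj × κ.Mor) (u : κ.Mor) =>
        ∃ y : κ.Obj × κ.Mor, y ∈ K (x.1, x.2.1, x.2.2.1) ∧ (κ.hom y.1 x.2.2.2.1 u).Dom ∧
        κ.val x.2.1 y.1 y.2 ≫ κ.val y.1 x.2.2.2.1 u = κ.val x.2.1 x.2.2.2.1 x.2.2.2.2) (by
      refine REPred.ex <| (hK.rePred_mem (by fun_prop) (by fun_prop)).and <| hE.mem_hom.and <|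
        REHom.eq hE (.comp hE hE.val hE.val) hE.val)
    refine ⟨K, F, hK, hF, fun a b m f hf => ?_⟩
    obtain ⟨k, n, hy, e, he, hef⟩ := h a b m f hf
    refine ⟨k, n, hy, e, he, hef.1, fun l q t ht htf => ?_⟩
    obtain ⟨u, hu, -⟩ := hef.2 t htf
    obtain ⟨c, hc⟩ := hE.hom_complete _ _ u
    obtain ⟨c', hc', y, hy', hd, h₆⟩ := h' (a, b, m, l, q) ⟨c, _, hy, hc.1, by
      simpa only [val_of_mem hc, val_of_mem he, val_of_mem ht] using hu⟩
    obtain rfl := Part.mem_unique hy' hy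
    refine Outputs.unique (p := fun v => e ≫ v = t) ⟨c', hc', _, val_mem hd, ?_⟩ (fun _ h => h)
      (hef.2 t htf)
    simpa only [val_of_mem he, val_of_mem ht] using h₆
  monoLift := by
    obtain ⟨F, hF, h⟩ := hE.exists_algorithm
      (β := κ.Obj × κ.Obj × κ.Mor × κ.Obj × κ.Mor) (a := fun x => x.2.2.2.1) (b := fun x => x.1)
      (p := fun x f => f ≫ κ.val x.1 x.2.1 x.2.2.1 = κ.val x.2.2.2.1 x.2.1 x.2.2.2.2)
      (REHom.eq hE (.comp hE hE.val hE.val) hE.val)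
    refine ⟨F, hF, fun k a m i hi _ l q t ht w => ?_⟩
    have huniq : ∃! u, u ≫ i = t := ⟨Abelian.monoLift i t w, Abelian.monoLift_comp i t w,
      fun u hu => by rw [← cancel_mono i, hu, Abelian.monoLift_comp]⟩
    have := h (k, a, m, l, q)
    simp only [val_of_mem hi, val_of_mem ht] at this
    exact (this huniq.exists).unique (fun _ h => h) huniq
  epiColift := by
    obtain ⟨F, hF, h⟩ := hE.exists_algorithm
      (β := κ.Obj × κ.Obj × κ.Mor × κ.Obj × κ.Mor) (a := fun x => x.2.1) (b := fun x => x.2.2.2.1)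
      (p := fun x f => κ.val x.1 x.2.1 x.2.2.1 ≫ f = κ.val x.1 x.2.2.2.1 x.2.2.2.2)
      (REHom.eq hE (.comp hE hE.val hE.val) hE.val)
    refine ⟨F, hF, fun b k m e he _ l q t ht w => ?_⟩
    have huniq : ∃! u, e ≫ u = t := ⟨Abelian.epiDesc e t w, Abelian.comp_epiDesc e t w,
      fun u hu => by rw [← cancel_epi e, hu, Abelian.comp_epiDesc]⟩
    have := h (b, k, m, l, q)
    simp only [val_of_mem he, val_of_mem ht] at this
    exact (this huniq.exists).unique (fun _ h => h) huniq

end Effective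

end Coding

/-! ### Gabriel morphisms and the morphisms of the Serre quotient. -/

section

variable {A : Type*} [Category* A]

/-- For monos this says that intersecting a subobject with a smaller one gives the smaller one. With
its dual, it lets sums with a restriction be computed without passing to new middle objects. -/
theorem CategoryTheory.IsPullback.of_factorization {X Y Z : A} (u : X ⟶ Y) (i : Y ⟶ Z) [Mono i] :
    IsPullback u (𝟙 X) i (u ≫ i) where
  w := by simp
  isLimit' := ⟨PullbackCone.IsLimit.mk _ (fun s => s.snd)
    (fun s => by rw [← cancel_mono i, s.condition, Category.assoc]) (fun s => Category.comp_id _)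
    fun s m _ hm => by simpa using hm⟩

theorem CategoryTheory.IsPushout.of_factorization {X Y Z : A} (e : X ⟶ Y) [Epi e] (v : Y ⟶ Z) :
    IsPushout e (e ≫ v) v (𝟙 Z) where
  w := by simp
  isColimit' := ⟨PushoutCocone.IsColimit.mk _ (fun s => s.inr)
    (fun s => by rw [← cancel_epi e, s.condition, Category.assoc]) (fun s => Category.id_comp _)
    fun s m _ hm => by simpa using hm⟩

namespace GenTriple

variable [Abelian A] {M N : A}

/-- Sums and differences of triples can be formed on any pullback and pushout. -/
theorem adapt_equivalent_of_isPullback (op : ∀ {X Y : A}, (X ⟶ Y) → (X ⟶ Y) → (X ⟶ Y))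
    (hl : ∀ {X Y Z : A} (f : X ⟶ Y) (g g' : Y ⟶ Z), f ≫ op g g' = op (f ≫ g) (f ≫ g'))
    (hr : ∀ {X Y Z : A} (f f' : X ⟶ Y) (g : Y ⟶ Z), op f f' ≫ g = op (f ≫ g) (f' ≫ g))
    {r s t : GenTriple M N} {p : r.dom ⟶ s.dom} {p' : r.dom ⟶ t.dom} {n : s.cod ⟶ r.cod}
    {n' : t.cod ⟶ r.cod} (hP : IsPullback p p' s.ι t.ι) (hV : IsPushout s.j t.j n n')
    (hι : p ≫ s.ι = r.ι) (hj : s.j ≫ n = r.j)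
    (hm : r.mid = op (p ≫ s.mid ≫ n) (p' ≫ t.mid ≫ n')) : (adapt op s t).Equivalent r := by
  refine ⟨hP.isoPullback.symm, hV.isoPushout.symm, ?_, ?_, ?_⟩
  · simp only [adapt, ← hι, Iso.symm_hom, IsPullback.isoPullback_inv_fst_assoc]
  · rw [← hj, Iso.symm_hom]
    simp only [adapt, Category.assoc, hV.inl_isoPushout_inv]
  · rw [hm]
    simp only [adapt, hl, hr, Iso.symm_hom, Category.assoc, hV.inl_isoPushout_inv,
      hV.inr_isoPushout_inv, IsPullback.isoPullback_inv_fst_assoc,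
      IsPullback.isoPullback_inv_snd_assoc]

section Quotient

variable {C : ObjectProperty A} [C.IsSerreClass] {D : Type*} [Category* D] (Q : A ⥤ D)
  [Q.IsLocalization C.isoModSerre]

theorem IsGabriel.isIso_map_ι {t : GenTriple M N} (h : t.IsGabriel C) : IsIso (Q.map t.ι) :=
  Localization.inverts Q C.isoModSerre _ h.isoModSerre_ι

theorem IsGabriel.isIso_map_j {t : GenTriple M N} (h : t.IsGabriel C) : IsIso (Q.map t.j) :=
  Localization.inverts Q C.isoModSerre _ h.isoModSerre_j

theorem map_comp_toQuotient_comp_map {t : GenTriple M N} (h : t.IsGabriel C) :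
    Q.map t.ι ≫ t.toQuotient Q h ≫ Q.map t.j = Q.map t.mid := by
  have e₁ : (Localization.isoOfHom Q C.isoModSerre t.ι h.isoModSerre_ι).hom = Q.map t.ι := rfl
  have e₂ : (Localization.isoOfHom Q C.isoModSerre t.j h.isoModSerre_j).hom = Q.map t.j := rfl
  rw [← e₁, ← e₂, toQuotient]
  simp only [Category.assoc, Iso.inv_hom_id, Iso.hom_inv_id_assoc, Category.comp_id]

/-- Both `Q(ι)` and `Q(j)` are invertible. Identities about represented morphisms are checked in
this form, which contains no inverses. -/
theorem toQuotient_eq_iff {t : GenTriple M N} (h : t.IsGabriel C) (f : Q.obj M ⟶ Q.obj N) :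
    t.toQuotient Q h = f ↔ Q.map t.ι ≫ f ≫ Q.map t.j = Q.map t.mid := by
  have := h.isIso_map_ι Q
  have := h.isIso_map_j Q
  rw [← map_comp_toQuotient_comp_map Q h, cancel_epi, cancel_mono, eq_comm]

end Quotient

end GenTriple

namespace GabrielHom

variable [Abelian A] {C : ObjectProperty A} {M N : A}

theorem mk_eq_of_equivalent {s t : GenTriple M N} (hs : s.IsGabriel C) (ht : t.IsGabriel C)
    (h : s.Equivalent t) : mk s hs = mk t ht :=
  Quotient.sound h

theorem exists_mk (φ : GabrielHom C M N) : ∃ t, ∃ h : t.IsGabriel C, φ = mk t h :=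
  Quotient.inductionOn φ fun t => ⟨t.1, t.2, rfl⟩

variable [C.IsSerreClass]

theorem mk_add_mk {r s t : GenTriple M N} (hr : r.IsGabriel C) (hs : s.IsGabriel C)
    (ht : t.IsGabriel C) {p : r.dom ⟶ s.dom} {p' : r.dom ⟶ t.dom} {n : s.cod ⟶ r.cod}
    {n' : t.cod ⟶ r.cod} (hP : IsPullback p p' s.ι t.ι) (hV : IsPushout s.j t.j n n')
    (hι : p ≫ s.ι = r.ι) (hj : s.j ≫ n = r.j)
    (hm : r.mid = p ≫ s.mid ≫ n + p' ≫ t.mid ≫ n') : mk s hs + mk t ht = mk r hr :=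
  Quotient.sound (GenTriple.adapt_equivalent_of_isPullback _ (by simp) (by simp) hP hV hι hj hm)

theorem mk_sub_mk {r s t : GenTriple M N} (hr : r.IsGabriel C) (hs : s.IsGabriel C)
    (ht : t.IsGabriel C) {p : r.dom ⟶ s.dom} {p' : r.dom ⟶ t.dom} {n : s.cod ⟶ r.cod}
    {n' : t.cod ⟶ r.cod} (hP : IsPullback p p' s.ι t.ι) (hV : IsPushout s.j t.j n n')
    (hι : p ≫ s.ι = r.ι) (hj : s.j ≫ n = r.j)
    (hm : r.mid = p ≫ s.mid ≫ n - p' ≫ t.mid ≫ n') : mk s hs - mk t ht = mk r hr :=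
  Quotient.sound (GenTriple.adapt_equivalent_of_isPullback _ (by simp) (by simp) hP hV hι hj hm)

/-- The restriction of a Gabriel morphism to a smaller subobject and a smaller quotient is smaller
in the natural partial order. -/
theorem naturalLE_of_restriction {s t : GenTriple M N} (hs : s.IsGabriel C) (ht : t.IsGabriel C)
    (u : s.dom ⟶ t.dom) (v : t.cod ⟶ s.cod) (hι : u ≫ t.ι = s.ι) (hj : t.j ≫ v = s.j)
    (hm : u ≫ t.mid ≫ v = s.mid) : naturalLE (mk s hs) (mk t ht) := by
  obtain ⟨X, Y, i, m, q⟩ := s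
  dsimp only at u v hι hj hm
  subst hι hj hm
  have hn : GenTriple.IsGabriel C (GenTriple.mk X Y (u ≫ t.ι) (-(u ≫ t.mid ≫ v)) (t.j ≫ v)) := hs
  have hz : GenTriple.IsGabriel C (GenTriple.mk X Y (u ≫ t.ι) 0 (t.j ≫ v)) := hs
  -- On the middle objects of `s` the two triples cancel. What remains is the zero triple there,
  -- which is neutral for `s`.
  have h₁ : mk t ht + mk _ hn = mk _ hz :=
    mk_add_mk hz ht hn (.of_factorization u t.ι) (.of_factorization t.j v) rfl rfl (by simp)
  have h₂ : mk _ hz + mk _ hs = mk _ hs := by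
    refine mk_add_mk hs hz hs (p := 𝟙 X) (p' := 𝟙 X) (n := 𝟙 Y) (n' := 𝟙 Y) ?_ ?_ (by simp)
      (by simp) (by simp)
    · simpa using IsPullback.of_factorization (𝟙 X) (u ≫ t.ι)
    · simpa using IsPushout.of_factorization (t.j ≫ v) (𝟙 Y)
  have h₃ : mk t ht + -mk _ hs + mk _ hs = mk _ hs := (congrArg (· + mk _ hs) h₁).trans h₂
  exact h₃.symm

variable {D : Type*} [Category* D] (Q : A ⥤ D) [Q.IsLocalization C.isoModSerre]

theorem toQuotient_mk {t : GenTriple M N} (h : t.IsGabriel C) :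
    (mk t h).toQuotient Q = t.toQuotient Q h := rfl

/-- Write the morphism as a fraction with denominator `φ.s` and factor the latter as an epi `w`
followed by its image inclusion. The inclusion serves as `ι`. The epi `w`, whose kernel lies in `C`,
is moved to the other side by a pushout along the numerator, where it becomes `j`. -/
theorem toQuotient_surjective :
    Function.Surjective (toQuotient Q : GabrielHom C M N → (Q.obj M ⟶ Q.obj N)) := by
  intro f
  obtain ⟨φ, hφ⟩ := Localization.exists_rightFraction Q C.isoModSerre f
  have hs : C.isoModSerre φ.s := φ.hs
  let w := Abelian.factorThruImage φ.s
  let t : GenTriple M N :=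
    { dom := Abelian.image φ.s, cod := pushout w φ.f, ι := Abelian.image.ι φ.s,
      mid := pushout.inl w φ.f, j := pushout.inr w φ.f }
  have hw : C.isoModSerre w := hs.1.isoModSerre_factorThruImage
  have ht : t.IsGabriel C := ⟨hs.2.isoModSerre_image_ι.2, MorphismProperty.pushout_inr _ _ hw.1⟩
  refine ⟨mk t ht, (t.toQuotient_eq_iff Q ht f).2 ?_⟩
  have hf : Q.map φ.s ≫ f = Q.map φ.f := by rw [hφ, φ.map_s_comp_map]
  have := Localization.inverts Q C.isoModSerre w hw
  have hws : w ≫ Abelian.image.ι φ.s = φ.s := kernel.lift_ι _ _ _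
  rw [← cancel_epi (Q.map w), ← Q.map_comp_assoc]
  change Q.map (w ≫ Abelian.image.ι φ.s) ≫ f ≫ Q.map (pushout.inr w φ.f) =
    Q.map w ≫ Q.map (pushout.inl w φ.f)
  rw [hws, reassoc_of% hf, ← Q.map_comp, ← Q.map_comp, pushout.condition]

variable [Preadditive D] [Q.Additive]

theorem toQuotient_add (φ ψ : GabrielHom C M N) :
    (φ + ψ).toQuotient Q = φ.toQuotient Q + ψ.toQuotient Q := by
  obtain ⟨s, hs, rfl⟩ := φ.exists_mk
  obtain ⟨t, ht, rfl⟩ := ψ.exists_mk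
  refine (GenTriple.toQuotient_eq_iff Q (hs.adapt _ ht) _).2 ?_
  simp only [GenTriple.adapt, toQuotient_mk, Preadditive.add_comp, Preadditive.comp_add, Q.map_add]
  congr 1
  · simp only [Q.map_comp, Category.assoc, ← GenTriple.map_comp_toQuotient_comp_map Q hs]
  · rw [pullback.condition, pushout.condition]
    simp only [Q.map_comp, Category.assoc, ← GenTriple.map_comp_toQuotient_comp_map Q ht]

theorem toQuotient_neg (φ : GabrielHom C M N) : (-φ).toQuotient Q = -φ.toQuotient Q := by
  obtain ⟨s, hs, rfl⟩ := φ.exists_mk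
  refine (GenTriple.toQuotient_eq_iff Q (t := s.neg) hs _).2 ?_
  simp only [GenTriple.neg, toQuotient_mk, Preadditive.neg_comp, Preadditive.comp_neg, Q.map_neg,
    GenTriple.map_comp_toQuotient_comp_map Q hs]

theorem toQuotient_sub (φ ψ : GabrielHom C M N) :
    (φ - ψ).toQuotient Q = φ.toQuotient Q - ψ.toQuotient Q := by
  obtain ⟨s, hs, rfl⟩ := φ.exists_mk
  obtain ⟨t, ht, rfl⟩ := ψ.exists_mk
  refine (GenTriple.toQuotient_eq_iff Q (hs.adapt _ ht) _).2 ?_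
  simp only [GenTriple.adapt, toQuotient_mk, Preadditive.sub_comp, Preadditive.comp_sub, Q.map_sub]
  congr 1
  · simp only [Q.map_comp, Category.assoc, ← GenTriple.map_comp_toQuotient_comp_map Q hs]
  · rw [pullback.condition, pushout.condition]
    simp only [Q.map_comp, Category.assoc, ← GenTriple.map_comp_toQuotient_comp_map Q ht]

theorem toQuotient_eq_of_naturalLE {χ φ : GabrielHom C M N} (h : naturalLE χ φ) :
    χ.toQuotient Q = φ.toQuotient Q := by
  have := congrArg (toQuotient Q) h
  rw [toQuotient_add, toQuotient_add, toQuotient_neg] at this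
  simpa using this

/-- If the images agree, the difference `d`, formed on the pullback and the pushout, satisfies `Q(d)
= 0`, so its image lies in `C`. That image is isomorphic to the cokernel of the inclusion of `kernel
d`, which may therefore be used as a smaller domain. There both morphisms agree, and this
restriction is the lower bound. Conversely, in the group of morphisms of the quotient, `χ = φ - χ +
χ` forces `χ = φ`. -/
theorem toQuotient_eq_iff_exists_naturalLE (φ ψ : GabrielHom C M N) :
    φ.toQuotient Q = ψ.toQuotient Q ↔ ∃ χ, naturalLE χ φ ∧ naturalLE χ ψ := by
  refine ⟨fun h => ?_, fun ⟨χ, h₁, h₂⟩ =>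
    (toQuotient_eq_of_naturalLE Q h₁).symm.trans (toQuotient_eq_of_naturalLE Q h₂)⟩
  have hd : (φ - ψ).toQuotient Q = 0 := by rw [toQuotient_sub, h, sub_self]
  obtain ⟨s, hs, rfl⟩ := φ.exists_mk
  obtain ⟨t, ht, rfl⟩ := ψ.exists_mk
  let p := pullback.fst s.ι t.ι
  let p' := pullback.snd s.ι t.ι
  let n := pushout.inl s.j t.j
  let n' := pushout.inr s.j t.j
  let d := p ≫ s.mid ≫ n - p' ≫ t.mid ≫ n'
  have hst : (s.sub t).IsGabriel C := hs.adapt _ ht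
  have hd' : Q.map d = 0 := by
    have := GenTriple.map_comp_toQuotient_comp_map Q hst
    rw [show (s.sub t).toQuotient Q hst = 0 from hd, zero_comp, comp_zero] at this
    exact this.symm
  have hC := (ObjectProperty.SerreClassLocalization.map_eq_zero_iff Q C d).1 hd'
  have hk : C.epiModSerre (kernel.ι d) :=
    ((C.isoModSerre_iff_of_mono _).1 <| by
      simpa only [ObjectProperty.isoModSerre_iff_of_mono] using!
        C.prop_of_iso (Abelian.coimageIsoImage d).symm hC)
  let r : GenTriple M N :=
    { dom := kernel d, cod := pushout s.j t.j, ι := kernel.ι d ≫ p ≫ s.ι,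
      mid := kernel.ι d ≫ p ≫ s.mid ≫ n, j := s.j ≫ n }
  have hr : r.IsGabriel C := ⟨C.epiModSerre.comp_mem _ _ hk hst.1, hst.2⟩
  refine ⟨mk r hr, naturalLE_of_restriction hr hs (kernel.ι d ≫ p) n ?_ rfl ?_,
    naturalLE_of_restriction hr ht (kernel.ι d ≫ p') n' ?_ pushout.condition.symm ?_⟩
  · simp only [r, Category.assoc]
  · simp only [r, Category.assoc]
  · simp only [r, p, p', Category.assoc, pullback.condition]
  · have := kernel.condition d
    rw [Preadditive.comp_sub, sub_eq_zero] at this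
    simp only [r, Category.assoc, this]

/-- An idempotent maps to an idempotent of a group, that is, to zero. Conversely, the zero triple
with identities as mono and epi is an idempotent against which any morphism with image zero can be
compared. -/
theorem mem_zeroid_iff (φ : GabrielHom C M N) :
    φ ∈ zeroid (GabrielHom C M N) ↔ φ.toQuotient Q = 0 := by
  constructor
  · rintro ⟨e, he, h⟩
    rw [(toQuotient_eq_iff_exists_naturalLE Q φ e).2 h]
    simpa [toQuotient_add] using congrArg (toQuotient Q) he
  · intro h
    have hz : GenTriple.IsGabriel C (GenTriple.mk M N (𝟙 M) 0 (𝟙 N)) :=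
      ⟨C.epiModSerre_of_epi _, C.monoModSerre_of_mono _⟩
    refine ⟨mk _ hz, ?_, (toQuotient_eq_iff_exists_naturalLE Q _ _).1 ?_⟩
    · refine mk_add_mk hz hz hz (p := 𝟙 M) (p' := 𝟙 M) (n := 𝟙 N) (n' := 𝟙 N) ?_ ?_ (by simp)
        (by simp) (by simp)
      · simpa using IsPullback.of_factorization (𝟙 M) (𝟙 M)
      · simpa using IsPushout.of_factorization (𝟙 N) (𝟙 N)
    · rw [h, eq_comm, toQuotient_mk, GenTriple.toQuotient_eq_iff]
      simp

end GabrielHom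

end

/-! ### Enumerable criteria: pullbacks, pushouts and equality in the quotient. -/

section

variable {A : Type*} [Category* A] [Abelian A]

/-- The preimage of a subobject under `f` is the kernel of `f` followed by the projection to the
factor object; the second leg is determined because `g` is a mono. This reduces the recognition of
pullbacks to that of kernels and cokernels. -/
theorem CategoryTheory.isPullback_iff_isKernel {P X Y Z K : A} {p : P ⟶ X} {p' : P ⟶ Y} {f : X ⟶ Z}
    {g : Y ⟶ Z} [Mono g] {e : Z ⟶ K} (he : IsCokernel e g) :
    IsPullback p p' f g ↔ p ≫ f = p' ≫ g ∧ IsKernel p (f ≫ e) := by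
  constructor
  · intro h
    refine ⟨h.w, by rw [← Category.assoc, h.w, Category.assoc, he.1, comp_zero], fun T t ht => ?_⟩
    have : Mono p := by
      rw [← h.isoPullback_hom_fst]; infer_instance
    obtain ⟨v, hv, -⟩ := he.2 (cokernel.π g) (cokernel.condition g)
    have w : (t ≫ f) ≫ cokernel.π g = 0 := by
      rw [← hv]
      simp only [Category.assoc] at ht ⊢
      rw [reassoc_of% ht, zero_comp]
    refine ⟨h.lift t (Abelian.monoLift g (t ≫ f) w) (Abelian.monoLift_comp _ _ _).symm,
      h.lift_fst _ _ _, fun u hu => ?_⟩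
    rw [← cancel_mono p, hu, h.lift_fst]
  · rintro ⟨w, h⟩
    have hs (s : PullbackCone f g) : s.fst ≫ f ≫ e = 0 := by
      rw [← Category.assoc, s.condition, Category.assoc, he.1, comp_zero]
    refine ⟨⟨w⟩, ⟨PullbackCone.IsLimit.mk _ (fun s => (h.2 s.fst (hs s)).choose)
      (fun s => (h.2 s.fst (hs s)).choose_spec.1) (fun s => ?_) fun s m hm _ =>
        (h.2 s.fst (hs s)).choose_spec.2 m hm⟩⟩
    rw [← cancel_mono g, Category.assoc, ← w, ← s.condition, ← Category.assoc]
    exact congrArg (· ≫ f) (h.2 s.fst (hs s)).choose_spec.1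

theorem CategoryTheory.isPushout_iff_isCokernel {P X Y Z K : A} {p : X ⟶ P} {p' : Y ⟶ P}
    {f : Z ⟶ X} {g : Z ⟶ Y} [Epi g] {i : K ⟶ Z} (hi : IsKernel i g) :
    IsPushout f g p p' ↔ f ≫ p = g ≫ p' ∧ IsCokernel p (i ≫ f) := by
  constructor
  · intro h
    refine ⟨h.w, by rw [Category.assoc, h.w, ← Category.assoc, hi.1, zero_comp], fun T t ht => ?_⟩
    have : Epi p := by
      rw [← h.inl_isoPushout_inv]; infer_instance
    obtain ⟨v, hv, -⟩ := hi.2 (kernel.ι g) (kernel.condition g)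
    have w : kernel.ι g ≫ f ≫ t = 0 := by
      rw [← hv]
      simp only [Category.assoc] at ht ⊢
      rw [ht, comp_zero]
    refine ⟨h.desc t (Abelian.epiDesc g (f ≫ t) w) (Abelian.comp_epiDesc _ _ _).symm,
      h.inl_desc _ _ _, fun u hu => ?_⟩
    rw [← cancel_epi p, hu, h.inl_desc]
  · rintro ⟨w, h⟩
    have hs (s : PushoutCocone f g) : (i ≫ f) ≫ s.inl = 0 := by
      rw [Category.assoc, s.condition, ← Category.assoc, hi.1, zero_comp]
    refine ⟨⟨w⟩, ⟨PushoutCocone.IsColimit.mk _ (fun s => (h.2 s.inl (hs s)).choose)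
      (fun s => (h.2 s.inl (hs s)).choose_spec.1) (fun s => ?_) fun s m hm _ =>
        (h.2 s.inl (hs s)).choose_spec.2 m hm⟩⟩
    rw [← cancel_epi g, ← Category.assoc, ← w, ← s.condition, Category.assoc]
    exact congrArg (f ≫ ·) (h.2 s.inl (hs s)).choose_spec.1

section Quotient

variable {C : ObjectProperty A} [C.IsSerreClass] {D : Type*} [Category* D] (Q : A ⥤ D)
  [Q.IsLocalization C.isoModSerre] [Preadditive D] [Q.Additive]

/-- `Q(f)` vanishes iff the image of `f` lies in `C`, and the image is isomorphic to the coimage.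
Any kernel may be used, in particular one with a code. -/
theorem CategoryTheory.IsKernel.map_eq_zero_iff {K X Y : A} {i : K ⟶ X} {f : X ⟶ Y}
    (h : IsKernel i f) : Q.map f = 0 ↔ C (cokernel i) := by
  obtain ⟨e, rfl⟩ := h.exists_iso (isKernel_kernel_ι f)
  rw [ObjectProperty.SerreClassLocalization.map_eq_zero_iff Q C]
  exact C.prop_iff_of_iso (Abelian.coimageIsoImage f).symm |>.trans
    (C.prop_iff_of_iso (cokernelEpiComp e.hom (kernel.ι f)).symm)

include C in
variable (C) in
theorem CategoryTheory.IsKernel.map {K X Y : A} {i : K ⟶ X} {f : X ⟶ Y} (h : IsKernel i f) :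
    IsKernel (Q.map i) (Q.map f) := by
  obtain ⟨w, ⟨hl⟩⟩ := isKernel_iff.1 h
  have := ObjectProperty.SerreClassLocalization.preservesKernel Q C f
  exact isKernel_iff.2 ⟨by rw [← Q.map_comp, w, Q.map_zero],
    ⟨(KernelFork.isLimitMapConeEquiv _ Q) (isLimitOfPreserves Q hl)⟩⟩

include C in
variable (C) in
theorem CategoryTheory.IsCokernel.map {X Y K : A} {f : X ⟶ Y} {e : Y ⟶ K} (h : IsCokernel e f) :
    IsCokernel (Q.map e) (Q.map f) := by
  obtain ⟨w, ⟨hl⟩⟩ := isCokernel_iff.1 h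
  have := ObjectProperty.SerreClassLocalization.preservesCokernel Q C f
  exact isCokernel_iff.2 ⟨by rw [← Q.map_comp, w, Q.map_zero],
    ⟨(CokernelCofork.isColimitMapCoconeEquiv _ Q) (isColimitOfPreserves Q hl)⟩⟩

variable {M N W : A}

/-- A fraction and a Gabriel morphism represent the same morphism of the Serre quotient iff they
agree up to morphisms whose kernel and cokernel lie in `C`. -/
theorem GenTriple.map_comp_toQuotient_eq_iff {t : GenTriple M N} (h : t.IsGabriel C) (s : W ⟶ M)
    (r : W ⟶ N) : Q.map s ≫ t.toQuotient Q h = Q.map r ↔ ∃ (X : A) (y : X ⟶ W) (z : X ⟶ t.dom),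
      IsIso (Q.map y) ∧ y ≫ s = z ≫ t.ι ∧ Q.map (z ≫ t.mid - y ≫ r ≫ t.j) = 0 := by
  have := h.isIso_map_j Q
  constructor
  · intro H
    -- The pullback of `s` along `ι` is the common refinement: its projection to `W` is a base
    -- change of `ι`, hence inverted by `Q`.
    have hy : C.isoModSerre (pullback.fst s t.ι) :=
      MorphismProperty.pullback_fst _ _ h.isoModSerre_ι
    refine ⟨pullback s t.ι, pullback.fst _ _, pullback.snd _ _,
      Localization.inverts Q C.isoModSerre _ hy, pullback.condition, ?_⟩
    rw [Q.map_sub, sub_eq_zero, Q.map_comp, Q.map_comp, Q.map_comp, ← H,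
      ← map_comp_toQuotient_comp_map Q h, Category.assoc, ← Q.map_comp_assoc, ← pullback.condition,
      Q.map_comp_assoc]
  · rintro ⟨X, y, z, _, w, H⟩
    rw [Q.map_sub, sub_eq_zero, Q.map_comp, Q.map_comp, Q.map_comp,
      ← map_comp_toQuotient_comp_map Q h, ← Q.map_comp_assoc, ← w, Q.map_comp_assoc, cancel_epi,
      ← Category.assoc, cancel_mono] at H
    exact H

end Quotient

end

/-! ### Enumerable properties of coded morphisms, and codes of Gabriel morphisms. -/

namespace Coding

variable {A : Type*} [Category* A] [Abelian A] {κ : Coding A}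

section Decisions

variable (hκ : κ.IsConstructivelyAbelian) {α : Type*} [Primcodable α]
  {a b k : α → κ.Obj} {f : ∀ x, κ.obj (a x) ⟶ κ.obj (b x)}

include hκ

/-- A coded kernel can be searched for, and by invariance under isomorphism `P` may be tested on it.
Being zero, lying in `C` and the negations of both are all treated in this way. -/
theorem IsConstructivelyAbelian.kernel_prop (P : ObjectProperty A) [P.IsClosedUnderIsomorphisms]
    (hP : REPred fun a => P (κ.obj a)) (hf : κ.REHom a b f) :
    REPred fun x => P (kernel (f x)) := by
  have hE := hκ.isEffective
  have ha := hf.source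
  have : REPred fun x => ∃ k : κ.Obj, ∃ i : κ.obj k ⟶ κ.obj (a x),
      IsKernel i (f x) ∧ P (κ.obj k) :=
    REPred.ex <| hE.ex_hom <| (hκ.isKernel (hf.reindex (by fun_prop)) hE.val).and
      (hP.comp (by fun_prop))
  refine this.of_eq fun x => ⟨?_, fun h => ?_⟩
  · rintro ⟨k, i, hi, hk⟩
    obtain ⟨e, -⟩ := hi.exists_iso (isKernel_kernel_ι _)
    exact P.prop_of_iso e hk
  · obtain ⟨k, ⟨e⟩⟩ := hκ.obj_complete (kernel (f x))
    exact ⟨k, _, (isKernel_kernel_ι _).iso_comp e, P.prop_of_iso e.symm h⟩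

theorem IsConstructivelyAbelian.cokernel_prop (P : ObjectProperty A) [P.IsClosedUnderIsomorphisms]
    (hP : REPred fun a => P (κ.obj a)) (hf : κ.REHom a b f) :
    REPred fun x => P (cokernel (f x)) := by
  have hE := hκ.isEffective
  have hb := hf.target
  have : REPred fun x => ∃ k : κ.Obj, ∃ e : κ.obj (b x) ⟶ κ.obj k,
      IsCokernel e (f x) ∧ P (κ.obj k) :=
    REPred.ex <| hE.ex_hom <| (hκ.isCokernel (hf.reindex (by fun_prop)) hE.val).and
      (hP.comp (by fun_prop))
  refine this.of_eq fun x => ⟨?_, fun h => ?_⟩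
  · rintro ⟨k, i, hi, hk⟩
    obtain ⟨e, -⟩ := hi.exists_iso (isCokernel_cokernel_π _)
    exact P.prop_of_iso e hk
  · obtain ⟨k, ⟨e⟩⟩ := hκ.obj_complete (cokernel (f x))
    exact ⟨k, _, (isCokernel_cokernel_π _).comp_iso e.symm, P.prop_of_iso e.symm h⟩

instance isClosedUnderIsomorphisms_not (P : ObjectProperty A) [P.IsClosedUnderIsomorphisms] :
    ObjectProperty.IsClosedUnderIsomorphisms fun X => ¬ P X where
  of_iso e h h' := h (P.prop_of_iso e.symm h')

theorem IsConstructivelyAbelian.isZero_obj : REPred fun a => IsZero (κ.obj a) := by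
  have hE := hκ.isEffective
  simp only [IsZero.iff_id_eq_zero]
  exact REHom.eq hE (.id hE (by fun_prop)) (.zero hE (by fun_prop) (by fun_prop))

theorem IsConstructivelyAbelian.not_isZero_obj : REPred fun a => ¬ IsZero (κ.obj a) := by
  have hE := hκ.isEffective
  simp only [IsZero.iff_id_eq_zero]
  exact REHom.ne hE (.id hE (by fun_prop)) (.zero hE (by fun_prop) (by fun_prop))

theorem IsConstructivelyAbelian.mono (hf : κ.REHom a b f) : REPred fun x => Mono (f x) :=
  (hκ.kernel_prop IsZero hκ.isZero_obj hf).of_eq fun _ =>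
    ⟨fun h => Preadditive.mono_of_isZero_kernel _ h, fun _ => isZero_kernel_of_mono _⟩

theorem IsConstructivelyAbelian.not_mono (hf : κ.REHom a b f) : REPred fun x => ¬ Mono (f x) :=
  (hκ.kernel_prop (fun X => ¬ IsZero X) hκ.not_isZero_obj hf).of_eq fun _ => not_congr
    ⟨fun h => Preadditive.mono_of_isZero_kernel _ h, fun _ => isZero_kernel_of_mono _⟩

theorem IsConstructivelyAbelian.epi (hf : κ.REHom a b f) : REPred fun x => Epi (f x) :=
  (hκ.cokernel_prop IsZero hκ.isZero_obj hf).of_eq fun _ =>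
    ⟨fun h => Preadditive.epi_of_isZero_cokernel _ h, fun _ => isZero_cokernel_of_epi _⟩

theorem IsConstructivelyAbelian.not_epi (hf : κ.REHom a b f) : REPred fun x => ¬ Epi (f x) :=
  (hκ.cokernel_prop (fun X => ¬ IsZero X) hκ.not_isZero_obj hf).of_eq fun _ => not_congr
    ⟨fun h => Preadditive.epi_of_isZero_cokernel _ h, fun _ => isZero_cokernel_of_epi _⟩

variable {C : ObjectProperty A} [C.IsSerreClass] (hC : ComputablePred fun a : κ.Obj => C (κ.obj a))
  {D : Type*} [Category* D] (Q : A ⥤ D) [Q.IsLocalization C.isoModSerre] [Preadditive D]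
  [Q.Additive]

include hC

theorem IsConstructivelyAbelian.isIso_map (hf : κ.REHom a b f) :
    REPred fun x => IsIso (Q.map (f x)) :=
  ((hκ.kernel_prop C hC.to_re hf).and (hκ.cokernel_prop C hC.to_re hf)).of_eq fun _ =>
    (ObjectProperty.SerreClassLocalization.isIso_map_iff Q C _).symm

theorem IsConstructivelyAbelian.map_eq_zero (hf : κ.REHom a b f) :
    REPred fun x => Q.map (f x) = 0 := by
  have hE := hκ.isEffective
  have ha := hf.source
  have : REPred fun x => ∃ k : κ.Obj, ∃ i : κ.obj k ⟶ κ.obj (a x),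
      IsKernel i (f x) ∧ C (cokernel i) :=
    REPred.ex <| hE.ex_hom <| (hκ.isKernel (hf.reindex (by fun_prop)) hE.val).and
      (hκ.cokernel_prop C hC.to_re hE.val)
  refine this.of_eq fun x => ⟨fun ⟨k, i, hi, h⟩ => (hi.map_eq_zero_iff Q).2 h, fun h => ?_⟩
  obtain ⟨k, ⟨e⟩⟩ := hκ.obj_complete (kernel (f x))
  have hi := (isKernel_kernel_ι (f x)).iso_comp e
  exact ⟨k, _, hi, (hi.map_eq_zero_iff Q).1 h⟩

/-- The certificate is a coded kernel together with a proof that its cokernel does not lie in `C`.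
Enumerability of `C` alone would not suffice here: its complement has to be enumerable too. -/
theorem IsConstructivelyAbelian.map_ne_zero (hf : κ.REHom a b f) :
    REPred fun x => Q.map (f x) ≠ 0 := by
  have hE := hκ.isEffective
  have ha := hf.source
  have : REPred fun x => ∃ k : κ.Obj, ∃ i : κ.obj k ⟶ κ.obj (a x),
      IsKernel i (f x) ∧ ¬ C (cokernel i) :=
    REPred.ex <| hE.ex_hom <| (hκ.isKernel (hf.reindex (by fun_prop)) hE.val).and
      (hκ.cokernel_prop (fun X => ¬ C X) hC.not.to_re hE.val)
  refine this.of_eq fun x =>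
    ⟨fun ⟨k, i, hi, h⟩ => (hi.map_eq_zero_iff Q).not.2 h, fun h => ?_⟩
  obtain ⟨k, ⟨e⟩⟩ := hκ.obj_complete (kernel (f x))
  have hi := (isKernel_kernel_ι (f x)).iso_comp e
  exact ⟨k, _, hi, (hi.map_eq_zero_iff Q).not.1 h⟩

end Decisions

section Gabriel

variable (κ) (C : ObjectProperty A)

/-- The triple of codes is the code of a Gabriel morphism. -/
structure IsGabrielCode (a b : κ.Obj) (c : κ.TripleCode) : Prop where
  ι_dom : (κ.hom c.1 a c.2.2.1).Dom
  mid_dom : (κ.hom c.1 c.2.1 c.2.2.2.1).Dom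
  j_dom : (κ.hom b c.2.1 c.2.2.2.2).Dom
  mono_ι : Mono (κ.val c.1 a c.2.2.1)
  epi_j : Epi (κ.val b c.2.1 c.2.2.2.2)
  cokernel_ι : C (cokernel (κ.val c.1 a c.2.2.1))
  kernel_j : C (kernel (κ.val b c.2.1 c.2.2.2.2))

variable {κ C} {a b : κ.Obj} {c : κ.TripleCode}

namespace IsGabrielCode

/-- The triple with a given code. -/
noncomputable def triple (h : κ.IsGabrielCode C a b c) : GenTriple (κ.obj a) (κ.obj b) where
  dom := κ.obj c.1
  cod := κ.obj c.2.1
  ι := κ.val c.1 a c.2.2.1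
  mid := κ.val c.1 c.2.1 c.2.2.2.1
  j := κ.val b c.2.1 c.2.2.2.2
  mono_ι := h.mono_ι
  epi_j := h.epi_j

theorem isGabriel (h : κ.IsGabrielCode C a b c) : h.triple.IsGabriel C :=
  ⟨h.cokernel_ι, h.kernel_j⟩

end IsGabrielCode

theorem mem_gabrielHom_iff {φ : GabrielHom C (κ.obj a) (κ.obj b)} :
    φ ∈ κ.gabrielHom C a b c ↔
      ∃ h : κ.IsGabrielCode C a b c, φ = GabrielHom.mk h.triple h.isGabriel := by
  simp only [gabrielHom, Part.mem_bind_iff, Part.mem_assert_iff, Part.mem_some_iff]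
  constructor
  · rintro ⟨ι, hι, f, hf, j, hj, ⟨h₁, h₂⟩, h, rfl⟩
    obtain rfl := val_of_mem hι
    obtain rfl := val_of_mem hf
    obtain rfl := val_of_mem hj
    exact ⟨⟨hι.1, hf.1, hj.1, h₁, h₂, h.1, h.2⟩, rfl⟩
  · rintro ⟨h, rfl⟩
    exact ⟨_, val_mem h.ι_dom, _, val_mem h.mid_dom, _, val_mem h.j_dom, ⟨h.mono_ι, h.epi_j⟩,
      h.isGabriel, rfl⟩

theorem IsConstructivelyAbelian.exists_mem_gabrielHom [C.IsSerreClass]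
    (hκ : κ.IsConstructivelyAbelian) (φ : GabrielHom C (κ.obj a) (κ.obj b)) :
    ∃ c, φ ∈ κ.gabrielHom C a b c := by
  obtain ⟨t, ht, rfl⟩ := φ.exists_mk
  obtain ⟨k, ⟨e⟩⟩ := hκ.obj_complete t.dom
  obtain ⟨l, ⟨e'⟩⟩ := hκ.obj_complete t.cod
  obtain ⟨i, hi⟩ := hκ.hom_complete _ _ (e.hom ≫ t.ι)
  obtain ⟨m, hm⟩ := hκ.hom_complete _ _ (e.hom ≫ t.mid ≫ e'.inv)
  obtain ⟨q, hq⟩ := hκ.hom_complete _ _ (t.j ≫ e'.inv)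
  have hc : κ.IsGabrielCode C a b (k, l, i, m, q) := by
    refine ⟨hi.1, hm.1, hq.1, ?_, ?_, ?_, ?_⟩
    · rw [val_of_mem hi]; infer_instance
    · rw [val_of_mem hq]; infer_instance
    · rw [val_of_mem hi]
      exact C.epiModSerre.comp_mem _ _ (C.epiModSerre_of_epi _) ht.1
    · rw [val_of_mem hq]
      exact C.monoModSerre.comp_mem _ _ ht.2 (C.monoModSerre_of_mono _)
  refine ⟨_, mem_gabrielHom_iff.2 ⟨hc, GabrielHom.mk_eq_of_equivalent _ _ ?_⟩⟩
  refine ⟨e.symm, e'.symm, ?_, ?_, ?_⟩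
  · simp [IsGabrielCode.triple, val_of_mem hi]
  · simp [IsGabrielCode.triple, val_of_mem hq]
  · simp [IsGabrielCode.triple, val_of_mem hm]

variable [C.IsSerreClass] {D : Type*} [Category* D] (Q : A ⥤ D) [Q.IsLocalization C.isoModSerre]

variable (κ C a b c) in
/-- The morphism `f` of the Serre quotient is represented by the Gabriel morphism with the code
`c`. -/
def IsQuotientCode (f : Q.obj (κ.obj a) ⟶ Q.obj (κ.obj b)) : Prop :=
  ∃ h : κ.IsGabrielCode C a b c, f = h.triple.toQuotient Q h.isGabriel

theorem mem_serreQuotient_hom_iff {f : Q.obj (κ.obj a) ⟶ Q.obj (κ.obj b)} :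
    f ∈ (κ.serreQuotient C Q).hom a b c ↔ κ.IsQuotientCode C a b c Q f := by
  refine (Part.mem_map_iff _).trans ⟨?_, fun ⟨h, hf⟩ => ?_⟩
  · rintro ⟨φ, hφ, rfl⟩
    obtain ⟨h, rfl⟩ := mem_gabrielHom_iff.1 hφ
    exact ⟨h, rfl⟩
  · exact ⟨_, mem_gabrielHom_iff.2 ⟨h, rfl⟩, hf.symm⟩

theorem serreQuotient_hom_dom_iff :
    ((κ.serreQuotient C Q).hom a b c).Dom ↔ κ.IsGabrielCode C a b c := by
  rw [Part.dom_iff_mem]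
  exact ⟨fun ⟨f, hf⟩ => ((mem_serreQuotient_hom_iff Q).1 hf).1,
    fun h => ⟨_, (mem_serreQuotient_hom_iff Q).2 ⟨h, rfl⟩⟩⟩

variable [Preadditive D] [Q.Additive]

/-- Up to the isomorphisms `Q(ι)` and `Q(j)` the represented morphism is `Q(mid)`. Its kernel is the
image of a kernel of `mid` under the exact functor `Q`, followed by `Q(ι)`. -/
theorem IsGabrielCode.isKernel {a b : κ.Obj} {c : κ.TripleCode} (h : κ.IsGabrielCode C a b c)
    {K : A} {i : K ⟶ κ.obj c.1} (hi : IsKernel i (κ.val c.1 c.2.1 c.2.2.2.1)) :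
    IsKernel (Q.map (i ≫ κ.val c.1 a c.2.2.1)) (h.triple.toQuotient Q h.isGabriel) := by
  have hf := GenTriple.map_comp_toQuotient_comp_map Q h.isGabriel
  have hQ := hi.map C Q
  change Q.map (κ.val c.1 a c.2.2.1) ≫ _ ≫ Q.map (κ.val b c.2.1 c.2.2.2.2) =
    Q.map (κ.val c.1 c.2.1 c.2.2.2.1) at hf
  have : IsIso (Q.map (κ.val c.1 a c.2.2.1)) := h.isGabriel.isIso_map_ι Q
  have : IsIso (Q.map (κ.val b c.2.1 c.2.2.2.2)) := h.isGabriel.isIso_map_j Q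
  have := hQ.mono
  refine ⟨?_, fun T t ht => ?_⟩
  · rw [← cancel_mono (Q.map (κ.val b c.2.1 c.2.2.2.2)), Q.map_comp, Category.assoc,
      Category.assoc, hf, hQ.1, zero_comp]
  · obtain ⟨u, hu, -⟩ := hQ.2 (t ≫ inv (Q.map (κ.val c.1 a c.2.2.1))) (by
      rw [← hf, Category.assoc, IsIso.inv_hom_id_assoc, reassoc_of% ht, zero_comp])
    refine ⟨u, by dsimp only; rw [Q.map_comp, reassoc_of% hu, IsIso.inv_hom_id, Category.comp_id],
      fun v hv => ?_⟩
    rw [← cancel_mono (Q.map i), hu, ← hv, Q.map_comp, Category.assoc, Category.assoc,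
      IsIso.hom_inv_id, Category.comp_id]

theorem IsGabrielCode.isCokernel {a b : κ.Obj} {c : κ.TripleCode} (h : κ.IsGabrielCode C a b c)
    {K : A} {e : κ.obj c.2.1 ⟶ K} (he : IsCokernel e (κ.val c.1 c.2.1 c.2.2.2.1)) :
    IsCokernel (Q.map (κ.val b c.2.1 c.2.2.2.2 ≫ e)) (h.triple.toQuotient Q h.isGabriel) := by
  have hf := GenTriple.map_comp_toQuotient_comp_map Q h.isGabriel
  have hQ := he.map C Q
  change Q.map (κ.val c.1 a c.2.2.1) ≫ _ ≫ Q.map (κ.val b c.2.1 c.2.2.2.2) =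
    Q.map (κ.val c.1 c.2.1 c.2.2.2.1) at hf
  have : IsIso (Q.map (κ.val c.1 a c.2.2.1)) := h.isGabriel.isIso_map_ι Q
  have : IsIso (Q.map (κ.val b c.2.1 c.2.2.2.2)) := h.isGabriel.isIso_map_j Q
  have := hQ.epi
  refine ⟨?_, fun T t ht => ?_⟩
  · rw [← cancel_epi (Q.map (κ.val c.1 a c.2.2.1)), Q.map_comp, reassoc_of% hf, hQ.1, comp_zero]
  · obtain ⟨u, hu, -⟩ := hQ.2 (inv (Q.map (κ.val b c.2.1 c.2.2.2.2)) ≫ t) (by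
      rw [← hf, Category.assoc, Category.assoc, IsIso.hom_inv_id_assoc, ht, comp_zero])
    refine ⟨u, by dsimp only; rw [Q.map_comp, Category.assoc, hu, IsIso.hom_inv_id_assoc],
      fun v hv => ?_⟩
    rw [← cancel_epi (Q.map e), hu, ← hv, Q.map_comp, Category.assoc, IsIso.inv_hom_id_assoc]

end Gabriel

end Coding

/-! ### Algorithms for the Serre quotient and for Gabriel morphisms. -/

namespace Coding

variable {A : Type*} [Category* A] [Abelian A] {κ : Coding A} (hκ : κ.IsConstructivelyAbelian)
  {C : ObjectProperty A} [C.IsSerreClass] (hC : ComputablePred fun a : κ.Obj => C (κ.obj a))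

include hκ

section

variable {α : Type*} [Primcodable α] {a b W : α → κ.Obj} {c : α → κ.TripleCode}

include hC

theorem IsConstructivelyAbelian.isGabrielCode (ha : Computable a) (hb : Computable b)
    (hc : Computable c) : REPred fun x => κ.IsGabrielCode C (a x) (b x) (c x) := by
  have hE := hκ.isEffective
  refine ((hE.mem_hom (a := fun x => (c x).1) (b := a) (m := fun x => (c x).2.2.1)).and
    ((hE.mem_hom (a := fun x => (c x).1) (b := fun x => (c x).2.1)
      (m := fun x => (c x).2.2.2.1)).and
    ((hE.mem_hom (a := b) (b := fun x => (c x).2.1) (m := fun x => (c x).2.2.2.2)).and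
    ((hκ.mono (hE.val (a := fun x => (c x).1) (b := a) (m := fun x => (c x).2.2.1))).and
    ((hκ.epi (hE.val (a := b) (b := fun x => (c x).2.1) (m := fun x => (c x).2.2.2.2))).and
    ((hκ.cokernel_prop C hC.to_re
      (hE.val (a := fun x => (c x).1) (b := a) (m := fun x => (c x).2.2.1))).and
    (hκ.kernel_prop C hC.to_re
      (hE.val (a := b) (b := fun x => (c x).2.1) (m := fun x => (c x).2.2.2.2))))))))).of_eq
    fun x => ⟨fun ⟨h₁, h₂, h₃, h₄, h₅, h₆, h₇⟩ => ⟨h₁, h₂, h₃, h₄, h₅, h₆, h₇⟩,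
      fun ⟨h₁, h₂, h₃, h₄, h₅, h₆, h₇⟩ => ⟨h₁, h₂, h₃, h₄, h₅, h₆, h₇⟩⟩

/-- Post's theorem: each of the seven conditions has an enumerable negation, so failure is a
disjunction of enumerable properties. -/
theorem IsConstructivelyAbelian.computablePred_isGabrielCode :
    ComputablePred fun x : κ.Obj × κ.Obj × κ.TripleCode =>
      κ.IsGabrielCode C x.1 x.2.1 x.2.2 := by
  have hE := hκ.isEffective
  have hd {a b : κ.Obj × κ.Obj × κ.TripleCode → κ.Obj}
      {m : κ.Obj × κ.Obj × κ.TripleCode → κ.Mor} (ha : Computable a) (hb : Computable b)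
      (hm : Computable m) : REPred fun x => ¬ (κ.hom (a x) (b x) (m x)).Dom :=
    hE.membership.not.to_re.comp (g := fun x => (a x, b x, m x)) (by fun_prop)
  refine ComputablePred.computable_iff_re_compl_re'.2
    ⟨hκ.isGabrielCode hC (by fun_prop) (by fun_prop) (by fun_prop), ?_⟩
  refine ((hd (a := fun x => x.2.2.1) (b := fun x => x.1) (m := fun x => x.2.2.2.2.1)
      (by fun_prop) (by fun_prop) (by fun_prop)).or
    ((hd (a := fun x => x.2.2.1) (b := fun x => x.2.2.2.1) (m := fun x => x.2.2.2.2.2.1)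
      (by fun_prop) (by fun_prop) (by fun_prop)).or
    ((hd (a := fun x => x.2.1) (b := fun x => x.2.2.2.1) (m := fun x => x.2.2.2.2.2.2)
      (by fun_prop) (by fun_prop) (by fun_prop)).or
    ((hκ.not_mono (hE.val (a := fun x => x.2.2.1) (b := fun x => x.1)
      (m := fun x => x.2.2.2.2.1))).or
    ((hκ.not_epi (hE.val (a := fun x => x.2.1) (b := fun x => x.2.2.2.1)
      (m := fun x => x.2.2.2.2.2.2))).or
    ((hκ.cokernel_prop (fun X => ¬ C X) hC.not.to_re
      (hE.val (a := fun x => x.2.2.1) (b := fun x => x.1) (m := fun x => x.2.2.2.2.1))).or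
    (hκ.kernel_prop (fun X => ¬ C X) hC.not.to_re
      (hE.val (a := fun x => x.2.1) (b := fun x => x.2.2.2.1)
        (m := fun x => x.2.2.2.2.2.2))))))))).of_eq fun x => ?_
  have : κ.IsGabrielCode C x.1 x.2.1 x.2.2 ↔ _ ∧ _ ∧ _ ∧ _ ∧ _ ∧ _ ∧ _ :=
    ⟨fun ⟨h₁, h₂, h₃, h₄, h₅, h₆, h₇⟩ => ⟨h₁, h₂, h₃, h₄, h₅, h₆, h₇⟩,
      fun ⟨h₁, h₂, h₃, h₄, h₅, h₆, h₇⟩ => ⟨h₁, h₂, h₃, h₄, h₅, h₆, h₇⟩⟩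
  rw [this]
  tauto

end

variable {D : Type*} [Category* D] (Q : A ⥤ D) [Q.IsLocalization C.isoModSerre]

theorem IsConstructivelyAbelian.exists_isQuotientCode (a b : κ.Obj)
    (f : Q.obj (κ.obj a) ⟶ Q.obj (κ.obj b)) : ∃ c, κ.IsQuotientCode C a b c Q f := by
  obtain ⟨φ, rfl⟩ := GabrielHom.toQuotient_surjective (C := C) Q f
  obtain ⟨c, hc⟩ := hκ.exists_mem_gabrielHom φ
  exact ⟨c, (mem_serreQuotient_hom_iff Q).1 (Part.mem_map _ hc)⟩

include C in
variable (C) in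
theorem IsConstructivelyAbelian.exists_fraction {M : A} {N : A} (f : Q.obj M ⟶ Q.obj N) :
    ∃ (w : κ.Obj) (s : κ.obj w ⟶ M) (t : κ.obj w ⟶ N), IsIso (Q.map s) ∧
      Q.map s ≫ f = Q.map t := by
  obtain ⟨φ, hφ⟩ := Localization.exists_rightFraction Q C.isoModSerre f
  obtain ⟨w, ⟨e⟩⟩ := hκ.obj_complete φ.X'
  have := Localization.inverts Q C.isoModSerre φ.s φ.hs
  refine ⟨w, e.hom ≫ φ.s, e.hom ≫ φ.f, by rw [Q.map_comp]; infer_instance, ?_⟩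
  rw [hφ, Q.map_comp, Category.assoc, φ.map_s_comp_map, Q.map_comp]

include C in
variable (C) in
/-- A common denominator of two morphisms with the same source. -/
theorem IsConstructivelyAbelian.exists_common_fraction {L M N : A} (f : Q.obj L ⟶ Q.obj M)
    (g : Q.obj L ⟶ Q.obj N) :
    ∃ (w : κ.Obj) (s : κ.obj w ⟶ L) (t : κ.obj w ⟶ M) (t' : κ.obj w ⟶ N), IsIso (Q.map s) ∧
      Q.map s ≫ f = Q.map t ∧ Q.map s ≫ g = Q.map t' := by
  obtain ⟨w, s, t, _, h⟩ := hκ.exists_fraction C Q f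
  obtain ⟨w', s', t', _, h'⟩ := hκ.exists_fraction C Q (Q.map s ≫ g)
  refine ⟨w', s' ≫ s, s' ≫ t, t', by rw [Q.map_comp]; infer_instance, ?_, ?_⟩
  · rw [Q.map_comp, Category.assoc, h, Q.map_comp]
  · rw [Q.map_comp, Category.assoc, h']

section

variable [Preadditive D] [Q.Additive]

include hC in
-- This translates statements about the quotient into searches in `A`. Morphisms of the quotient are
-- only accessible through fractions; where `Q(s)` is invertible, the equation determines `f`, so
-- the predicate says that the code represents the fraction of `s` and `t`.
theorem IsConstructivelyAbelian.represents {α : Type*} [Primcodable α] {a b W : α → κ.Obj}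
    {c : α → κ.TripleCode} (hc : Computable c) {s : ∀ x, κ.obj (W x) ⟶ κ.obj (a x)}
    {t : ∀ x, κ.obj (W x) ⟶ κ.obj (b x)} (hs : κ.REHom W a s) (ht : κ.REHom W b t) :
    REPred fun x => ∃ f, κ.IsQuotientCode C (a x) (b x) (c x) Q f ∧
      Q.map (s x) ≫ f = Q.map (t x) := by
  have hE := hκ.isEffective
  have ha := hs.target
  have hb := ht.target
  have hW := hs.source
  have : REPred fun x => κ.IsGabrielCode C (a x) (b x) (c x) ∧ ∃ X : κ.Obj,
      ∃ y : κ.obj X ⟶ κ.obj (W x), ∃ z : κ.obj X ⟶ κ.obj (c x).1, IsIso (Q.map y) ∧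
        y ≫ s x = z ≫ κ.val (c x).1 (a x) (c x).2.2.1 ∧
        Q.map (z ≫ κ.val (c x).1 (c x).2.1 (c x).2.2.2.1 -
          y ≫ t x ≫ κ.val (b x) (c x).2.1 (c x).2.2.2.2) = 0 :=
    (hκ.isGabrielCode hC ha hb hc).and <| REPred.ex <| hE.ex_hom <| hE.ex_hom <|
      (hκ.isIso_map hC Q hE.val).and <|
      (REHom.eq hE (.comp hE hE.val (hs.reindex (by fun_prop))) (.comp hE hE.val hE.val)).and <|
      hκ.map_eq_zero hC Q (.sub hE (.comp hE hE.val hE.val)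
        (.comp hE hE.val (.comp hE (ht.reindex (by fun_prop)) hE.val)))
  refine this.of_eq fun x => ⟨?_, ?_⟩
  · rintro ⟨h, X, y, z, H⟩
    exact ⟨_, ⟨h, rfl⟩, (GenTriple.map_comp_toQuotient_eq_iff Q h.isGabriel _ _).2 ⟨_, y, z, H⟩⟩
  · rintro ⟨f, ⟨h, rfl⟩, H⟩
    obtain ⟨X, y, z, h₁, h₂, h₃⟩ : ∃ (X : A) (y : X ⟶ κ.obj (W x)) (z : X ⟶ κ.obj (c x).1),
        IsIso (Q.map y) ∧ y ≫ s x = z ≫ κ.val (c x).1 (a x) (c x).2.2.1 ∧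
        Q.map (z ≫ κ.val (c x).1 (c x).2.1 (c x).2.2.2.1 -
          y ≫ t x ≫ κ.val (b x) (c x).2.1 (c x).2.2.2.2) = 0 :=
      (GenTriple.map_comp_toQuotient_eq_iff Q h.isGabriel _ _).1 H
    -- The refinement exists on some object of `A`; the search only meets coded ones.
    obtain ⟨k, ⟨e⟩⟩ := hκ.obj_complete X
    refine ⟨h, k, e.hom ≫ y, e.hom ≫ z, ?_, ?_, ?_⟩
    · rw [Q.map_comp]; infer_instance
    · rw [Category.assoc, h₂, Category.assoc]
    · have := congrArg (Q.map e.hom ≫ ·) h₃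
      simpa only [comp_zero, ← Q.map_comp, Preadditive.comp_sub, Category.assoc] using this

include hC in
-- Morphisms with the same source have a common denominator `s`. Over it, sums, equality and
-- inequality are those of the numerators, transported by `Q`.
theorem IsConstructivelyAbelian.isEffective_serreQuotient :
    (κ.serreQuotient C Q).IsEffective := by
  have hE := hκ.isEffective
  have hmem {a b : κ.Obj} {c : κ.TripleCode} {f : Q.obj (κ.obj a) ⟶ Q.obj (κ.obj b)} :=
    (mem_serreQuotient_hom_iff (C := C) (c := c) Q (f := f)).symm
  refine ⟨fun a b f => (hκ.exists_isQuotientCode Q a b f).imp fun _ => hmem.1, ?_, ?_, ?_, ?_, ?_⟩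
  · exact (hκ.computablePred_isGabrielCode hC).of_eq fun x => (serreQuotient_hom_dom_iff Q).symm
  · have : REPred fun x : κ.Obj × κ.TripleCode => ∃ f, κ.IsQuotientCode C x.1 x.1 x.2 Q f ∧
        Q.map (𝟙 (κ.obj x.1)) ≫ f = Q.map (𝟙 (κ.obj x.1)) :=
      hκ.represents hC Q (by fun_prop) (.id hE (by fun_prop)) (.id hE (by fun_prop))
    refine this.of_eq fun x => Iff.trans ⟨?_, fun h => ⟨_, h, Category.comp_id _⟩⟩ hmem
    rintro ⟨f, hf, h⟩
    simp only [Q.map_id, Category.id_comp] at h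
    rwa [h] at hf
  -- Over one denominator `s`, the numerator of `f` is `u` and that of `f ≫ g` is `t`. Then `Q(u) g
  -- = Q(t)` holds automatically, and conversely the three equations force the third morphism to be
  -- the composite.
  · have : REPred fun x : κ.Obj × κ.Obj × κ.Obj × κ.TripleCode × κ.TripleCode × κ.TripleCode =>
        ∃ w : κ.Obj, ∃ s : κ.obj w ⟶ κ.obj x.1, ∃ u : κ.obj w ⟶ κ.obj x.2.1,
        ∃ t : κ.obj w ⟶ κ.obj x.2.2.1, IsIso (Q.map s) ∧
        (∃ f, κ.IsQuotientCode C x.1 x.2.1 x.2.2.2.1 Q f ∧ Q.map s ≫ f = Q.map u) ∧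
        (∃ g, κ.IsQuotientCode C x.2.1 x.2.2.1 x.2.2.2.2.1 Q g ∧ Q.map u ≫ g = Q.map t) ∧
        (∃ h, κ.IsQuotientCode C x.1 x.2.2.1 x.2.2.2.2.2 Q h ∧ Q.map s ≫ h = Q.map t) :=
      REPred.ex <| hE.ex_hom <| hE.ex_hom <| hE.ex_hom <| (hκ.isIso_map hC Q hE.val).and <|
        (hκ.represents hC Q (by fun_prop) hE.val hE.val).and <|
        (hκ.represents hC Q (by fun_prop) hE.val hE.val).and <|
        hκ.represents hC Q (by fun_prop) hE.val hE.val
    refine this.of_eq fun x => Iff.trans ⟨?_, ?_⟩ (exists_congr fun f => and_congr hmem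
      (exists_congr fun g => and_congr hmem hmem))
    · rintro ⟨w, s, u, t, _, ⟨f, hf, h₁⟩, ⟨g, hg, h₂⟩, h, hh, h₃⟩
      refine ⟨f, hf, g, hg, ?_⟩
      have : f ≫ g = h := by
        rw [← cancel_epi (Q.map s), h₃, ← Category.assoc, h₁, h₂]
      exact this ▸ hh
    · rintro ⟨(f : Q.obj (κ.obj x.1) ⟶ Q.obj (κ.obj x.2.1)), hf,
        (g : Q.obj (κ.obj x.2.1) ⟶ Q.obj (κ.obj x.2.2.1)), hg, hfg⟩
      obtain ⟨w, s, u, t, hs, h₁, h₂⟩ := hκ.exists_common_fraction C Q f (f ≫ g)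
      refine ⟨w, s, u, t, hs, ⟨f, hf, h₁⟩, ⟨g, hg, ?_⟩, _, hfg, h₂⟩
      rw [← h₁, Category.assoc, h₂]
  · have : REPred fun x : κ.Obj × κ.Obj × κ.TripleCode × κ.TripleCode × κ.TripleCode =>
        ∃ w : κ.Obj, ∃ s : κ.obj w ⟶ κ.obj x.1, ∃ t : κ.obj w ⟶ κ.obj x.2.1,
        ∃ t' : κ.obj w ⟶ κ.obj x.2.1, IsIso (Q.map s) ∧
        (∃ f, κ.IsQuotientCode C x.1 x.2.1 x.2.2.1 Q f ∧ Q.map s ≫ f = Q.map t) ∧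
        (∃ g, κ.IsQuotientCode C x.1 x.2.1 x.2.2.2.1 Q g ∧ Q.map s ≫ g = Q.map t') ∧
        (∃ h, κ.IsQuotientCode C x.1 x.2.1 x.2.2.2.2 Q h ∧ Q.map s ≫ h = Q.map (t + t')) :=
      REPred.ex <| hE.ex_hom <| hE.ex_hom <| hE.ex_hom <| (hκ.isIso_map hC Q hE.val).and <|
        (hκ.represents hC Q (by fun_prop) hE.val hE.val).and <|
        (hκ.represents hC Q (by fun_prop) hE.val hE.val).and <|
        hκ.represents hC Q (by fun_prop) hE.val (.add hE hE.val hE.val)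
    refine this.of_eq fun x => Iff.trans ⟨?_, ?_⟩ (exists_congr fun f => and_congr hmem
      (exists_congr fun g => and_congr hmem hmem))
    · rintro ⟨w, s, t, t', _, ⟨f, hf, h₁⟩, ⟨g, hg, h₂⟩, h, hh, h₃⟩
      refine ⟨f, hf, g, hg, ?_⟩
      have : f + g = h := by
        rw [← cancel_epi (Q.map s), h₃, Preadditive.comp_add, h₁, h₂, Q.map_add]
      exact this ▸ hh
    · rintro ⟨(f : Q.obj (κ.obj x.1) ⟶ Q.obj (κ.obj x.2.1)), hf,
        (g : Q.obj (κ.obj x.1) ⟶ Q.obj (κ.obj x.2.1)), hg, hfg⟩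
      obtain ⟨w, s, t, t', hs, h₁, h₂⟩ := hκ.exists_common_fraction C Q f g
      refine ⟨w, s, t, t', hs, ⟨f, hf, h₁⟩, ⟨g, hg, h₂⟩, _, hfg, ?_⟩
      rw [Q.map_add, ← h₁, ← h₂]
      exact Preadditive.comp_add _ _ _ _ _ _
  · have : REPred fun x : κ.Obj × κ.Obj × κ.TripleCode × κ.TripleCode =>
        ∃ w : κ.Obj, ∃ s : κ.obj w ⟶ κ.obj x.1, ∃ t : κ.obj w ⟶ κ.obj x.2.1,
        ∃ t' : κ.obj w ⟶ κ.obj x.2.1, IsIso (Q.map s) ∧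
        (∃ f, κ.IsQuotientCode C x.1 x.2.1 x.2.2.1 Q f ∧ Q.map s ≫ f = Q.map t) ∧
        (∃ g, κ.IsQuotientCode C x.1 x.2.1 x.2.2.2 Q g ∧ Q.map s ≫ g = Q.map t') ∧
        Q.map (t - t') ≠ 0 :=
      REPred.ex <| hE.ex_hom <| hE.ex_hom <| hE.ex_hom <| (hκ.isIso_map hC Q hE.val).and <|
        (hκ.represents hC Q (by fun_prop) hE.val hE.val).and <|
        (hκ.represents hC Q (by fun_prop) hE.val hE.val).and <|
        hκ.map_ne_zero hC Q (.sub hE hE.val hE.val)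
    refine this.of_eq fun x => Iff.trans ⟨?_, ?_⟩ (exists_congr fun f => and_congr hmem
      (exists_congr fun g => and_congr_left' hmem))
    · rintro ⟨w, s, t, t', _, ⟨f, hf, h₁⟩, ⟨g, hg, h₂⟩, h₃⟩
      refine ⟨f, hf, g, hg, fun e => h₃ ?_⟩
      rw [Q.map_sub, ← h₁, ← h₂, e, sub_self]
    · rintro ⟨(f : Q.obj (κ.obj x.1) ⟶ Q.obj (κ.obj x.2.1)), hf,
        (g : Q.obj (κ.obj x.1) ⟶ Q.obj (κ.obj x.2.1)), hg, hfg⟩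
      obtain ⟨w, s, t, t', hs, h₁, h₂⟩ := hκ.exists_common_fraction C Q f g
      refine ⟨w, s, t, t', hs, ⟨f, hf, h₁⟩, ⟨g, hg, h₂⟩, fun e => hfg ?_⟩
      rwa [Q.map_sub, sub_eq_zero, ← h₁, ← h₂, cancel_epi] at e

end

include hC in
theorem IsConstructivelyAbelian.serreQuotient [Abelian D] [Q.Additive] :
    (κ.serreQuotient C Q).IsConstructivelyAbelian := by
  have hE := hκ.isEffective
  refine (hκ.isEffective_serreQuotient hC Q).isConstructivelyAbelian (fun X => ?_) ?_ ?_
  · have := Localization.essSurj Q C.isoModSerre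
    obtain ⟨a, ⟨e⟩⟩ := hκ.obj_complete (Q.objPreimage X)
    exact ⟨a, ⟨Q.mapIso e ≪≫ Q.objObjPreimageIso X⟩⟩
  -- The fraction with an identity as denominator expresses that the code found represents the image
  -- under `Q` of a morphism of `A`. The same is done for cokernels.
  · obtain ⟨K, hK, H⟩ := REPred.exists_choice
      (p := fun (x : κ.Obj × κ.Obj × κ.TripleCode) (y : κ.Obj × κ.TripleCode) =>
        ∃ i : κ.obj y.1 ⟶ κ.obj x.2.2.1,
          IsKernel i (κ.val x.2.2.1 x.2.2.2.1 x.2.2.2.2.2.1) ∧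
          ∃ g, κ.IsQuotientCode C y.1 x.1 y.2 Q g ∧
            Q.map (𝟙 _) ≫ g = Q.map (i ≫ κ.val x.2.2.1 x.1 x.2.2.2.2.1)) (by
        refine hE.ex_hom <| (hκ.isKernel hE.val hE.val).and <|
          hκ.represents hC Q (by fun_prop) (.id hE (by fun_prop)) (.comp hE hE.val hE.val))
    refine ⟨K, hK, fun (a b : κ.Obj) (c : κ.TripleCode)
      (f : Q.obj (κ.obj a) ⟶ Q.obj (κ.obj b)) hf => ?_⟩
    obtain ⟨h, rfl⟩ := (mem_serreQuotient_hom_iff Q).1 hf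
    obtain ⟨⟨k, n⟩, hy, i, hi, g, hg, e⟩ := H (a, b, c) (by
      obtain ⟨k, ⟨e⟩⟩ := hκ.obj_complete (kernel (κ.val c.1 c.2.1 c.2.2.2.1))
      have hi := (isKernel_kernel_ι (κ.val c.1 c.2.1 c.2.2.2.1)).iso_comp e
      obtain ⟨n, hn⟩ := hκ.exists_isQuotientCode (C := C) Q _ _
        (Q.map ((e.hom ≫ kernel.ι (κ.val c.1 c.2.1 c.2.2.2.1)) ≫ κ.val c.1 a c.2.2.1))
      exact ⟨(k, n), _, hi, _, hn, by rw [Q.map_id, Category.id_comp]⟩)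
    rw [Q.map_id, Category.id_comp] at e
    exact ⟨k, n, hy, g, (mem_serreQuotient_hom_iff Q).2 hg, e ▸ h.isKernel Q hi⟩
  · obtain ⟨K, hK, H⟩ := REPred.exists_choice
      (p := fun (x : κ.Obj × κ.Obj × κ.TripleCode) (y : κ.Obj × κ.TripleCode) =>
        ∃ e : κ.obj x.2.2.2.1 ⟶ κ.obj y.1,
          IsCokernel e (κ.val x.2.2.1 x.2.2.2.1 x.2.2.2.2.2.1) ∧
          ∃ g, κ.IsQuotientCode C x.2.1 y.1 y.2 Q g ∧
            Q.map (𝟙 _) ≫ g = Q.map (κ.val x.2.1 x.2.2.2.1 x.2.2.2.2.2.2 ≫ e)) (by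
        refine hE.ex_hom <| (hκ.isCokernel hE.val hE.val).and <|
          hκ.represents hC Q (by fun_prop) (.id hE (by fun_prop)) (.comp hE hE.val hE.val))
    refine ⟨K, hK, fun (a b : κ.Obj) (c : κ.TripleCode)
      (f : Q.obj (κ.obj a) ⟶ Q.obj (κ.obj b)) hf => ?_⟩
    obtain ⟨h, rfl⟩ := (mem_serreQuotient_hom_iff Q).1 hf
    obtain ⟨⟨k, n⟩, hy, i, hi, g, hg, e⟩ := H (a, b, c) (by
      obtain ⟨k, ⟨e⟩⟩ := hκ.obj_complete (cokernel (κ.val c.1 c.2.1 c.2.2.2.1))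
      have hi := (isCokernel_cokernel_π (κ.val c.1 c.2.1 c.2.2.2.1)).comp_iso e.symm
      obtain ⟨n, hn⟩ := hκ.exists_isQuotientCode (C := C) Q _ _
        (Q.map (κ.val b c.2.1 c.2.2.2.2 ≫ cokernel.π (κ.val c.1 c.2.1 c.2.2.2.1) ≫ e.symm.hom))
      exact ⟨(k, n), _, hi, _, hn, by rw [Q.map_id, Category.id_comp]⟩)
    rw [Q.map_id, Category.id_comp] at e
    exact ⟨k, n, hy, g, (mem_serreQuotient_hom_iff Q).2 hg, e ▸ h.isCokernel Q hi⟩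

include hC in
-- Gabriel morphisms are triples up to isomorphism, so any pullback and any pushout give the same
-- difference. The search looks for a coded triple with certificates that its middle objects are
-- such a pullback and pushout.
theorem IsConstructivelyAbelian.exists_difference :
    ∃ F : κ.Obj × κ.Obj × κ.TripleCode × κ.TripleCode →. κ.TripleCode, Partrec F ∧
      ∀ a b m n, ∀ φ ∈ κ.gabrielHom C a b m, ∀ ψ ∈ κ.gabrielHom C a b n,
        ∃ c ∈ F (a, b, m, n), φ - ψ ∈ κ.gabrielHom C a b c := by
  have hE := hκ.isEffective
  obtain ⟨F, hF, H⟩ := REPred.exists_choice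
    (p := fun (x : κ.Obj × κ.Obj × κ.TripleCode × κ.TripleCode) (c : κ.TripleCode) =>
      κ.IsGabrielCode C x.1 x.2.1 c ∧
      ∃ p : κ.obj c.1 ⟶ κ.obj x.2.2.1.1, ∃ p' : κ.obj c.1 ⟶ κ.obj x.2.2.2.1,
      ∃ n : κ.obj x.2.2.1.2.1 ⟶ κ.obj c.2.1, ∃ n' : κ.obj x.2.2.2.2.1 ⟶ κ.obj c.2.1,
      (p ≫ κ.val x.2.2.1.1 x.1 x.2.2.1.2.2.1 = p' ≫ κ.val x.2.2.2.1 x.1 x.2.2.2.2.2.1 ∧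
      ∃ k : κ.Obj, ∃ e : κ.obj x.1 ⟶ κ.obj k,
        IsCokernel e (κ.val x.2.2.2.1 x.1 x.2.2.2.2.2.1) ∧
        IsKernel p (κ.val x.2.2.1.1 x.1 x.2.2.1.2.2.1 ≫ e)) ∧
      (κ.val x.2.1 x.2.2.1.2.1 x.2.2.1.2.2.2.2 ≫ n =
        κ.val x.2.1 x.2.2.2.2.1 x.2.2.2.2.2.2.2 ≫ n' ∧
      ∃ k : κ.Obj, ∃ i : κ.obj k ⟶ κ.obj x.2.1,
        IsKernel i (κ.val x.2.1 x.2.2.2.2.1 x.2.2.2.2.2.2.2) ∧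
        IsCokernel n (i ≫ κ.val x.2.1 x.2.2.1.2.1 x.2.2.1.2.2.2.2)) ∧
      p ≫ κ.val x.2.2.1.1 x.1 x.2.2.1.2.2.1 = κ.val c.1 x.1 c.2.2.1 ∧
      κ.val x.2.1 x.2.2.1.2.1 x.2.2.1.2.2.2.2 ≫ n = κ.val x.2.1 c.2.1 c.2.2.2.2 ∧
      κ.val c.1 c.2.1 c.2.2.2.1 =
        p ≫ κ.val x.2.2.1.1 x.2.2.1.2.1 x.2.2.1.2.2.2.1 ≫ n -
        p' ≫ κ.val x.2.2.2.1 x.2.2.2.2.1 x.2.2.2.2.2.2.1 ≫ n') (by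
    refine (hκ.isGabrielCode hC (by fun_prop) (by fun_prop) (by fun_prop)).and <|
      hE.ex_hom <| hE.ex_hom <| hE.ex_hom <| hE.ex_hom <|
      ((REHom.eq hE (.comp hE hE.val hE.val) (.comp hE hE.val hE.val)).and <|
        REPred.ex <| hE.ex_hom <| (hκ.isCokernel hE.val hE.val).and <|
        hκ.isKernel (.comp hE hE.val hE.val) hE.val).and <|
      ((REHom.eq hE (.comp hE hE.val hE.val) (.comp hE hE.val hE.val)).and <|
        REPred.ex <| hE.ex_hom <| (hκ.isKernel hE.val hE.val).and <|
        hκ.isCokernel (.comp hE hE.val hE.val) hE.val).and <|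
      (REHom.eq hE (.comp hE hE.val hE.val) hE.val).and <|
      (REHom.eq hE (.comp hE hE.val hE.val) hE.val).and <|
      REHom.eq hE hE.val (.sub hE (.comp hE hE.val (.comp hE hE.val hE.val))
        (.comp hE hE.val (.comp hE hE.val hE.val))))
  refine ⟨F, hF, fun a b m n φ hφ ψ hψ => ?_⟩
  obtain ⟨hs, rfl⟩ := mem_gabrielHom_iff.1 hφ
  obtain ⟨ht, rfl⟩ := mem_gabrielHom_iff.1 hψ
  have := ht.mono_ι
  have := ht.epi_j
  obtain ⟨c, hc, hr, p, p', u, u', ⟨w, _, e, he, hp⟩, ⟨w', _, i, hi, hu⟩, hι, hj, hm⟩ :=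
    H (a, b, m, n) (by
      -- The search succeeds: the difference has a code, and the chosen pullback and pushout are
      -- carried to its middle objects by the isomorphisms `μ` and `ν`.
      obtain ⟨c, hc⟩ := hκ.exists_mem_gabrielHom
        (GabrielHom.mk _ hs.isGabriel - GabrielHom.mk _ ht.isGabriel)
      obtain ⟨hr, hc⟩ := mem_gabrielHom_iff.1 hc
      obtain ⟨μ, ν, h₁, h₂, h₃⟩ : (hs.triple.sub ht.triple).Equivalent hr.triple :=
        Quotient.exact hc
      obtain ⟨k, ⟨e⟩⟩ := hκ.obj_complete (cokernel (κ.val n.1 a n.2.2.1))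
      obtain ⟨l, ⟨i⟩⟩ := hκ.obj_complete (kernel (κ.val b n.2.1 n.2.2.2.2))
      have he := (isCokernel_cokernel_π (κ.val n.1 a n.2.2.1)).comp_iso e.symm
      have hi := (isKernel_kernel_ι (κ.val b n.2.1 n.2.2.2.2)).iso_comp i
      have hP : IsPullback (μ.inv ≫ pullback.fst hs.triple.ι ht.triple.ι)
          (μ.inv ≫ pullback.snd hs.triple.ι ht.triple.ι) hs.triple.ι ht.triple.ι :=
        (IsPullback.of_hasPullback hs.triple.ι ht.triple.ι).of_iso μ (Iso.refl _) (Iso.refl _)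
          (Iso.refl _) ((Category.comp_id _).trans (Iso.hom_inv_id_assoc μ _).symm)
          ((Category.comp_id _).trans (Iso.hom_inv_id_assoc μ _).symm) (by simp) (by simp)
      have hV : IsPushout hs.triple.j ht.triple.j (pushout.inl hs.triple.j ht.triple.j ≫ ν.hom)
          (pushout.inr hs.triple.j ht.triple.j ≫ ν.hom) :=
        (IsPushout.of_hasPushout hs.triple.j ht.triple.j).of_iso (Iso.refl _) (Iso.refl _)
          (Iso.refl _) ν (by simp) (by simp) (by simp) (by simp)
      refine ⟨c, hr, μ.inv ≫ pullback.fst hs.triple.ι ht.triple.ι,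
        μ.inv ≫ pullback.snd hs.triple.ι ht.triple.ι,
        pushout.inl hs.triple.j ht.triple.j ≫ ν.hom, pushout.inr hs.triple.j ht.triple.j ≫ ν.hom,
        ⟨hP.w, k, _, he, ((isPullback_iff_isKernel he).1 hP).2⟩,
        ⟨hV.w, l, _, hi, ((isPushout_iff_isCokernel hi).1 hV).2⟩, ?_, ?_, ?_⟩
      · exact (Category.assoc _ _ _).trans ((Iso.inv_comp_eq μ).2 h₁.symm)
      · exact (Category.assoc _ _ _).symm.trans h₂
      · refine ((Iso.eq_inv_comp μ).2 h₃).trans ?_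
        simp only [GenTriple.sub, GenTriple.adapt, Preadditive.sub_comp, Preadditive.comp_sub,
          Category.assoc]
        exact congrArg₂ (· - ·) (Category.assoc _ _ _).symm (Category.assoc _ _ _).symm)
  exact ⟨c, hc, mem_gabrielHom_iff.2 ⟨hr, GabrielHom.mk_sub_mk _ _ _
    ((isPullback_iff_isKernel he).2 ⟨w, hp⟩) ((isPushout_iff_isCokernel hi).2 ⟨w', hu⟩)
    hι hj hm⟩⟩

include hC in
-- Membership in the zeroid means image zero, hence `Q(mid) = 0`. Only the middle morphism has to be
-- inspected, and both outcomes have certificates.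
theorem IsConstructivelyAbelian.exists_decision_zeroid [Preadditive D] [Q.Additive] :
    ∃ F : κ.Obj × κ.Obj × κ.TripleCode →. Bool, Partrec F ∧
      ∀ a b m, ∀ φ ∈ κ.gabrielHom C a b m,
        ∃ r ∈ F (a, b, m), r = true ↔ φ ∈ zeroid (GabrielHom C (κ.obj a) (κ.obj b)) := by
  have hE := hκ.isEffective
  obtain ⟨F, hF, H⟩ := exists_decision (r := fun _ => True)
    (p := fun x : κ.Obj × κ.Obj × κ.TripleCode =>
      Q.map (κ.val x.2.2.1 x.2.2.2.1 x.2.2.2.2.2.1) = 0)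
    (hκ.map_eq_zero hC Q hE.val) (hκ.map_ne_zero hC Q hE.val) fun _ _ => Iff.rfl
  refine ⟨F, hF, fun a b m φ hφ => ?_⟩
  obtain ⟨r, hr, hr'⟩ := H (a, b, m) trivial
  refine ⟨r, hr, hr'.trans ?_⟩
  obtain ⟨h, rfl⟩ := mem_gabrielHom_iff.1 hφ
  rw [GabrielHom.mem_zeroid_iff Q, GabrielHom.toQuotient_mk, GenTriple.toQuotient_eq_iff,
    zero_comp, comp_zero, eq_comm]
  rfl

end Coding

/-- `Q : A ⥤ D` is the canonical functor to the Serre quotient `D = A/C`, i.e. the localization of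
`A` at the morphisms whose kernel and cokernel lie in `C`. -/
theorem theorem1p1 {A : Type*} [Category* A] [Abelian A]
    (κ : Coding A) (hκ : κ.IsConstructivelyAbelian)
    (C : ObjectProperty A) [C.IsSerreClass]
    (hC : ComputablePred fun a : κ.Obj => C (κ.obj a))
    {D : Type*} [Category* D] (Q : A ⥤ D) [Q.IsLocalization C.isoModSerre] :
    ∃ _ : Abelian D, Q.Additive ∧
      -- `A/C`, with its morphisms coded by Gabriel morphisms, is constructively Abelian
      (κ.serreQuotient C Q).IsConstructivelyAbelian ∧
      -- every morphism of `A/C` is represented by a Gabriel morphism, compatibly with addition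
      (∀ M N : A, Function.Surjective
        (GabrielHom.toQuotient Q : GabrielHom C M N → (Q.obj M ⟶ Q.obj N))) ∧
      (∀ (M N : A) (φ ψ : GabrielHom C M N),
        (φ + ψ).toQuotient Q = φ.toQuotient Q + ψ.toQuotient Q) ∧
      -- `Hom_{A/C}(M, N)` is the colimit of the groups `Hom_A(M', N/N')`: two Gabriel morphisms are
      -- equal in `A/C` iff they agree on a smaller subobject of `M` and a smaller quotient of `N`
      (∀ (M N : A) (φ ψ : GabrielHom C M N),
        φ.toQuotient Q = ψ.toQuotient Q ↔ ∃ χ, naturalLE χ φ ∧ naturalLE χ ψ) ∧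
      -- two Gabriel morphisms are equal in `A/C` iff their difference lies in the zeroid
      (∀ (M N : A) (φ ψ : GabrielHom C M N),
        φ.toQuotient Q = ψ.toQuotient Q ↔ φ - ψ ∈ zeroid (GabrielHom C M N)) ∧
      -- differences of Gabriel morphisms are computable
      (∃ F : κ.Obj × κ.Obj × κ.TripleCode × κ.TripleCode →. κ.TripleCode, Partrec F ∧
        ∀ a b m n, ∀ φ ∈ κ.gabrielHom C a b m, ∀ ψ ∈ κ.gabrielHom C a b n,
          ∃ c ∈ F (a, b, m, n), φ - ψ ∈ κ.gabrielHom C a b c) ∧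
      -- membership of Gabriel morphisms in the zeroid is decidable
      (∃ F : κ.Obj × κ.Obj × κ.TripleCode →. Bool, Partrec F ∧
        ∀ a b m, ∀ φ ∈ κ.gabrielHom C a b m,
          ∃ r ∈ F (a, b, m), r = true ↔ φ ∈ zeroid (GabrielHom C (κ.obj a) (κ.obj b))) := by
  let := Localization.preadditive Q C.isoModSerre
  have : Q.Additive := Localization.functor_additive Q C.isoModSerre
  let ab : Abelian D := ObjectProperty.SerreClassLocalization.abelian Q C
  refine ⟨ab, ‹_›, hκ.serreQuotient hC Q, fun M N => GabrielHom.toQuotient_surjective Q,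
    fun M N φ ψ => GabrielHom.toQuotient_add Q φ ψ,
    fun M N φ ψ => GabrielHom.toQuotient_eq_iff_exists_naturalLE Q φ ψ, fun M N φ ψ => ?_,
    hκ.exists_difference hC, hκ.exists_decision_zeroid hC Q⟩
  rw [GabrielHom.mem_zeroid_iff Q, GabrielHom.toQuotient_sub, sub_eq_zero]
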